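/- Let $R>0$, $\alpha,\gamma\in\mathbb R$ and $\gamma_1,\gamma_2>1$. Let $\varphi:(0,\infty)\to(0,\infty)$ be twice differentiable and such that - $t\varphi(t)\to0$ as $t\to0^+$, $t\varphi(t)\to\infty$ as $t\to\infty$, and $t\varphi(t)$ is strictly increasing on $(0,\infty)$; - $\gamma_1-1\le \dfrac{(t\varphi(t))'}{\varphi(t)}\le\gamma_2-1$ for all $t>0$. Assume $\gamma\ge\max\{\alpha,\,-\alpha/(\gamma_1-1)\}$. Let $f\in C(\mathbb R)\cap C^1(\mathbb R\setminus\{0\})$ satisfy $tf(t)>0$ for $t\ne0$, let $d_\infty>0$ be such that $f$ is nondecreasing on $(-\infty,d_\infty]$, and assume that $|f|^{-1/(\gamma_1-1)}$ is integrable on a neighbourhood of $0$. For $\lambda>0$ and $d\in(0,d_\infty]$ consider $$-\bigl(r^\alpha\varphi(|u'(r)|)u'(r)\bigr)'=\lambda r^\gamma f(u(r))\quad(r>0),\qquad u(0)=d,\quad u'(0)=0, \tag{$P_{\lambda,d}$}$$ where $\varphi(|u'|)u'$ is read as $0$ where $u'=0$. A solution is a function $u\in C^1([0,\infty))$ such that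 $r^\alpha\varphi(|u'|)u'$ is differentiable on $(0,\infty)$, the equation and the initial conditions hold, and $r^\alpha\varphi(|u'(r)|)u'(r)\to0$ as $r\to0^+$ (this last condition is automatic if $\alpha\ge0$). Then there is $\Lambda>0$ (depending on $d_\infty$ and the data $\varphi,f,\alpha,\gamma,\gamma_1,\gamma_2,R$, but not on $\lambda$ or $d$) such that for every $\lambda\in(0,\Lambda]$: 1. For every $d\in(0,d_\infty]$, problem $(P_{\lambda,d})$ has a unique solution $u(\cdot,d)$. 2. For every $d\in(0,d_\infty]$ there is an infinite sequence $0<z_1(d)<z_2(d)<\cdots$ of zeros of $u(\cdot,d)$ with $u(r,d)>0$ for $0<r<z_1(d)$, $u'(r,d)<0$ for $0<r\le z_1(d)$, and, for all $\ell\ge1$, $u(r,d)\ne0$ for $z_\ell(d)<r<z_{\ell+1}(d)$ and $u'(z_\ell(d),d)\ne0$. Moreover $z_1(d_\infty)\ge R$. 3. For every $\ell\ge1$, $z_\ell(d)\to0$ as $d\to0^+$, and $z_\ell(d)\to z_\ell(\underline d)$ as $d\to\underline d$ within $(0,d_\infty]$, for every $\underline d\in(0,d_\infty]$. 4. If $\underline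 d\in(0,d_\infty]$ and $u(\cdot,\underline d)$ has exactly $k$ zeros in $(0,R)$, then $u(\cdot,d)$ has at most $k+1$ zeros in $(0,R)$ for every $d<\underline d$ close enough to $\underline d$. -/

import Mathlib

open Set Filter Topology MeasureTheory

/-- `u` is a `C^1` solution on `[0, ∞)` of the initial value problem
`-(r^α φ(|u'|) u')' = lam r^γ f(u)` for `r > 0`, `u(0) = d`, `u'(0) = 0`.

Only the values of `u` on `[0, ∞)` matter.  The value of `φ` at `0` is irrelevant, since
`φ(|u'|) u'` is `0` where `u' = 0`.  The derivative of the flux `r^α φ(|u'|) u'` is required to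
exist at every `r > 0`.  For `α ≥ 0` the initial conditions force the flux to tend to `0` as
`r → 0+`; for `α < 0`, where `r^α` is singular at `0`, this is part of the notion of solution. -/
structure IsRadialSolution (φ f : ℝ → ℝ) (α γ lam d : ℝ) (u : ℝ → ℝ) : Prop where
  contDiffOn : ContDiffOn ℝ 1 u (Ici 0)
  init : u 0 = d
  init_deriv : HasDerivWithinAt u 0 (Ici 0) 0
  flux_zero : α < 0 → Tendsto (fun s => s ^ α * (φ |deriv u s| * deriv u s)) (𝓝[>] 0) (𝓝 0)
  equation : ∀ r, 0 < r →
    HasDerivAt (fun s => s ^ α * (φ |deriv u s| * deriv u s)) (-(lam * r ^ γ * f (u r))) r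

/-- The set of zeros of `u` in the open interval `(0, R)`. -/
def zerosIn (u : ℝ → ℝ) (R : ℝ) : Set ℝ := {r | r ∈ Ioo 0 R ∧ u r = 0}

/-! Let g be the inverse of t ↦ φ(|t|)t, put p = γ₁ - 1 and let y = r^α φ(|u'|)u' be the flux. The
problem becomes the system u' = g(r^(-α) y), y' = -λ r^γ f(u). The growth of φ enters only through
the fact that g(s)/s^(1/p) is nonincreasing on (0, ∞) (`exists_isFluxInverse`).

Let F and G be the primitives of f and g. The energy r^(α-γ) G(r^(-α) y) + λ F(u) has a derivative
free of f. It is nonincreasing because γ ≥ max(α, -α/p), and it tends to λ F(d) at 0. Hence F(u) ≤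
F(d), so u stays in a fixed potential well and f may be truncated to a bounded nondecreasing
function. Multiplied by a suitable power of r the energy is nondecreasing, so u and y never vanish
together.

Neither f nor g need be Lipschitz at 0, but the two singularities never meet. At a critical point u
≠ 0: there f is Lipschitz and the fluxes of two solutions are comparable to the same weight, so only
the relative variation of g matters. Where y ≠ 0, g is Lipschitz, and (u, energy) replaces (u, y):
the derivative of the energy does not see f, and F is locally Lipschitz. Existence comes from a
delayed integral equation and compactness. The same compactness together with uniqueness gives
continuity in d.

The trajectory turns in the (u, y) plane. Let Ψ be the primitive of |f|^(-1/p). In the middle third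
of a quarter turn of length at least ε, |r^(-α) y| dominates a multiple of |f(u)|, so Ψ(u) varies
with speed at least c(ε) > 0 (`phase_duration`). As Ψ is bounded on the well, every quarter turn
ends, which gives infinitely many zeros. As d → 0 the well shrinks to 0, so Ψ(u) → 0 and the quarter
turns shrink. The zeros are crossed with nonzero flux, hence move continuously with d. If u(·, d₀)
has exactly k zeros in (0, R) then its zero number k + 2 lies beyond R, and this persists for nearby
d. Finally, a small λ makes |u'| so small on [0, R] that a solution starting at d∞ cannot reach 0
before R. -/

theorem sub_le_sub_of_hasDerivAt_le {P Q P' Q' : ℝ → ℝ} {a b : ℝ} (hab : a ≤ b)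
    (hP : ContinuousOn P (Icc a b)) (hQ : ContinuousOn Q (Icc a b))
    (hP' : ∀ x ∈ Ioo a b, HasDerivAt P (P' x) x) (hQ' : ∀ x ∈ Ioo a b, HasDerivAt Q (Q' x) x)
    (h : ∀ x ∈ Ioo a b, P' x ≤ Q' x) : P b - P a ≤ Q b - Q a := by
  have hd : ∀ x ∈ Ioo a b, HasDerivAt (fun x => Q x - P x) (Q' x - P' x) x :=
    fun x hx => (hQ' x hx).sub (hP' x hx)
  have hm : MonotoneOn (fun x => Q x - P x) (Icc a b) := by
    apply monotoneOn_of_deriv_nonneg (convex_Icc a b) (f := fun x => Q x - P x) (hQ.sub hP)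
    · rw [interior_Icc]
      exact fun x hx => (hd x hx).differentiableAt.differentiableWithinAt
    · rw [interior_Icc]
      intro x hx
      rw [(hd x hx).deriv]
      linarith [h x hx]
  have := hm (left_mem_Icc.2 hab) (right_mem_Icc.2 hab) hab
  simp only at this
  linarith

/-! ### The inverse of the flux nonlinearity and its primitive -/

/-- The properties of the inverse `g` of `t ↦ φ(|t|) t` that the analysis uses: `g` is an odd
increasing continuous function and `g(s) / s^(1/p)` is nonincreasing on `(0, ∞)`. -/
structure IsFluxInverse (g : ℝ → ℝ) (p : ℝ) : Prop where
  p_pos : 0 < p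
  cont : Continuous g
  odd : ∀ s, g (-s) = -g s
  mono : StrictMono g
  growth : ∀ s t, 0 < s → s ≤ t → g t ≤ (t / s) ^ (1 / p) * g s

namespace IsFluxInverse

variable {g : ℝ → ℝ} {p : ℝ}

theorem map_zero (hg : IsFluxInverse g p) : g 0 = 0 := by
  have := hg.odd 0
  simp only [neg_zero] at this
  linarith

theorem pos (hg : IsFluxInverse g p) {s : ℝ} (hs : 0 < s) : 0 < g s := by
  have := hg.mono hs
  rwa [hg.map_zero] at this

theorem neg (hg : IsFluxInverse g p) {s : ℝ} (hs : s < 0) : g s < 0 := by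
  have := hg.mono hs
  rwa [hg.map_zero] at this

theorem nonneg (hg : IsFluxInverse g p) {s : ℝ} (hs : 0 ≤ s) : 0 ≤ g s := by
  have := hg.mono.monotone hs
  rwa [hg.map_zero] at this

theorem abs_map (hg : IsFluxInverse g p) (s : ℝ) : |g s| = g |s| := by
  rcases le_total 0 s with h | h
  · rw [abs_of_nonneg h, abs_of_nonneg (hg.nonneg h)]
  · have h1 : 0 ≤ g (-s) := hg.nonneg (by linarith)
    rw [hg.odd] at h1
    rw [abs_of_nonpos h, abs_of_nonpos (by linarith), hg.odd]

theorem abs_map_le (hg : IsFluxInverse g p) {s K : ℝ} (h : |s| ≤ K) : |g s| ≤ g K := by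
  rw [hg.abs_map]
  exact hg.mono.monotone h

/-- The relative variation of `g` is controlled by the relative variation of its argument. -/
theorem sub_le (hg : IsFluxInverse g p) {s t a a₀ : ℝ} (hs : 0 < s) (hst : s ≤ t)
    (ha : t - s ≤ a * s) (haa : a ≤ a₀) :
    g t - g s ≤ a / p * Real.exp (a₀ / p) * g s := by
  have hp := hg.p_pos
  have h0 : 0 ≤ a := by
    by_contra h
    nlinarith
  have h1 : t / s ≤ 1 + a := by
    rw [div_le_iff₀ hs]
    linarith
  have h2 : (t / s) ^ (1 / p) ≤ Real.exp (a / p) := by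
    calc (t / s) ^ (1 / p) ≤ (Real.exp a) ^ (1 / p) := by
          have ht : 0 < t := hs.trans_le hst
          apply Real.rpow_le_rpow (by positivity) _ (by positivity)
          linarith [Real.add_one_le_exp a]
      _ = Real.exp (a / p) := by
          rw [← Real.exp_mul]
          congr 1
          ring
  -- This is e^(-x) ≥ 1 - x multiplied by e^x.
  have h3 : Real.exp (a / p) - 1 ≤ a / p * Real.exp (a / p) := by
    have := Real.add_one_le_exp (-(a / p))
    have h4 := Real.exp_pos (a / p)
    have h5 : Real.exp (a / p) * Real.exp (-(a / p)) = 1 := by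
      rw [← Real.exp_add]
      simp
    nlinarith
  have h6 : Real.exp (a / p) ≤ Real.exp (a₀ / p) := by
    apply Real.exp_le_exp.2
    gcongr
  have h7 := hg.growth s t hs hst
  have h8 := hg.pos hs
  have h9 : a / p * Real.exp (a / p) ≤ a / p * Real.exp (a₀ / p) := by gcongr
  nlinarith

/-- Away from 0 a bound on the relative variation is a Lipschitz bound, since an increment t - s is
at most (t - s)/c times s. This serves uniqueness at points where the flux does not vanish. -/
theorem abs_sub_le_of_le (hg : IsFluxInverse g p) {c K : ℝ} (hc : 0 < c) {s t : ℝ}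
    (hs : s ∈ Icc c K) (ht : t ∈ Icc c K) :
    |g t - g s| ≤ (1 / (c * p) * Real.exp (K / c / p) * g K) * |t - s| := by
  wlog hst : s ≤ t generalizing s t
  · rw [abs_sub_comm, abs_sub_comm t s]
    exact this ht hs (le_of_not_ge hst)
  have hp := hg.p_pos
  have h1 := hg.mono.monotone hst
  rw [abs_of_nonneg (by linarith), abs_of_nonneg (by linarith)]
  have h2 := hg.sub_le (a := (t - s) / c) (a₀ := K / c) (lt_of_lt_of_le hc hs.1) hst
    (by
      rw [div_mul_eq_mul_div, le_div_iff₀ hc]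
      exact mul_le_mul_of_nonneg_left hs.1 (by linarith))
    (by
      have := hs.1
      have := ht.2
      gcongr
      linarith)
  have h3 : g s ≤ g K := hg.mono.monotone hs.2
  calc g t - g s ≤ (t - s) / c / p * Real.exp (K / c / p) * g s := h2
    _ ≤ (t - s) / c / p * Real.exp (K / c / p) * g K := by
        have : 0 ≤ t - s := by linarith
        gcongr
    _ = _ := by field_simp

/-- Lower power bound for `g` on bounded intervals. -/
theorem mul_rpow_le (hg : IsFluxInverse g p) {s S : ℝ} (hs : 0 ≤ s) (hS : s ≤ S) (hS0 : 0 < S) :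
    g S / S ^ (1 / p) * s ^ (1 / p) ≤ g s := by
  have hp := hg.p_pos
  rcases hs.eq_or_lt with h | h
  · rw [← h, Real.zero_rpow (by positivity), mul_zero, hg.map_zero]
  · have h1 := hg.growth s S h hS
    rw [Real.div_rpow hS0.le hs] at h1
    have h2 : 0 < s ^ (1 / p) := Real.rpow_pos_of_pos h _
    have h3 : 0 < S ^ (1 / p) := Real.rpow_pos_of_pos hS0 _
    rw [div_mul_eq_mul_div, div_le_iff₀ h3]
    calc g S * s ^ (1 / p) ≤ S ^ (1 / p) / s ^ (1 / p) * g s * s ^ (1 / p) := by gcongr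
      _ = g s * S ^ (1 / p) := by field_simp

end IsFluxInverse

/-- The primitive of `g`. -/
noncomputable def primitive (g : ℝ → ℝ) (w : ℝ) : ℝ := ∫ s in (0 : ℝ)..w, g s

theorem hasDerivAt_primitive {g : ℝ → ℝ} (hg : Continuous g) (w : ℝ) :
    HasDerivAt (primitive g) (g w) w :=
  intervalIntegral.integral_hasDerivAt_right (hg.intervalIntegrable _ _)
    (hg.stronglyMeasurableAtFilter _ _) hg.continuousAt

theorem continuous_primitive {g : ℝ → ℝ} (hg : Continuous g) : Continuous (primitive g) :=
  continuous_iff_continuousAt.2 fun w => (hasDerivAt_primitive hg w).continuousAt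

theorem primitive_zero (g : ℝ → ℝ) : primitive g 0 = 0 := intervalIntegral.integral_same

namespace IsFluxInverse

variable {g : ℝ → ℝ} {p : ℝ}

theorem primitive_neg (hg : IsFluxInverse g p) (w : ℝ) : primitive g (-w) = primitive g w := by
  unfold primitive
  have h := intervalIntegral.integral_comp_neg (a := 0) (b := w) g
  simp only [hg.odd, intervalIntegral.integral_neg, neg_zero] at h
  rw [intervalIntegral.integral_symm, ← h, neg_neg]

theorem mul_neg_self (hg : IsFluxInverse g p) (w : ℝ) : -w * g (-w) = w * g w := by
  rw [hg.odd]
  ring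

theorem mul_self_nonneg (hg : IsFluxInverse g p) (w : ℝ) : 0 ≤ w * g w := by
  rcases le_total 0 w with h | h
  · exact mul_nonneg h (hg.nonneg h)
  · rw [← hg.mul_neg_self]
    exact mul_nonneg (by linarith) (hg.nonneg (by linarith))

theorem primitive_nonneg (hg : IsFluxInverse g p) (w : ℝ) : 0 ≤ primitive g w := by
  wlog h : 0 ≤ w generalizing w
  · rw [← hg.primitive_neg]
    exact this _ (by linarith)
  · exact intervalIntegral.integral_nonneg h fun s hs => hg.nonneg hs.1

theorem primitive_le (hg : IsFluxInverse g p) (w : ℝ) : primitive g w ≤ w * g w := by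
  wlog h : 0 ≤ w generalizing w
  · rw [← hg.primitive_neg, ← hg.mul_neg_self]
    exact this _ (by linarith)
  · have := intervalIntegral.integral_mono_on (μ := volume) h (hg.cont.intervalIntegrable 0 w)
      (intervalIntegrable_const (c := g w)) (fun s hs => hg.mono.monotone hs.2)
    simpa [primitive] using this

/-- Integrate the lower power bound `mul_rpow_le` over [0, w]. The constant (p + 1)/p is what turns
-α ≤ γ p into monotonicity of the energy when α < 0. -/
theorem mul_self_le (hg : IsFluxInverse g p) (w : ℝ) :
    w * g w ≤ (p + 1) / p * primitive g w := by
  wlog h : 0 ≤ w generalizing w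
  · rw [← hg.primitive_neg, ← hg.mul_neg_self]
    exact this _ (by linarith)
  have hp := hg.p_pos
  rcases h.eq_or_lt with h0 | h0
  · simp [← h0, primitive_zero]
  have hi : ∫ s in (0 : ℝ)..w, g w / w ^ (1 / p) * s ^ (1 / p) =
      g w / w ^ (1 / p) * (w ^ (1 / p + 1) / (1 / p + 1)) := by
    rw [intervalIntegral.integral_const_mul, integral_rpow (Or.inl (by
      have : 0 < 1 / p := by positivity
      linarith)), Real.zero_rpow (by positivity), sub_zero]
  have hm := intervalIntegral.integral_mono_on h
    (f := fun s => g w / w ^ (1 / p) * s ^ (1 / p)) (g := g) (μ := volume)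
    ((continuous_const.mul (Real.continuous_rpow_const (by positivity))).intervalIntegrable _ _)
    (hg.cont.intervalIntegrable 0 w) (fun s hs => hg.mul_rpow_le hs.1 hs.2 h0)
  rw [hi, Real.rpow_add_one h0.ne'] at hm
  have h3 : 0 < w ^ (1 / p) := Real.rpow_pos_of_pos h0 _
  have h4 : g w / w ^ (1 / p) * (w ^ (1 / p) * w / (1 / p + 1)) = p / (p + 1) * (w * g w) := by
    field_simp
    ring
  rw [h4] at hm
  change _ ≤ primitive g w at hm
  calc w * g w = (p + 1) / p * (p / (p + 1) * (w * g w)) := by field_simp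
    _ ≤ _ := by gcongr

end IsFluxInverse

/-- The odd extension of t φ(t) is an increasing bijection of ℝ, so its inverse is an order
isomorphism and is automatically continuous. The lower bound on (tφ)'/φ says that t φ(t) / t^p is
nondecreasing. Read through the inverse, this is the growth property of g. -/
theorem exists_isFluxInverse {φ : ℝ → ℝ} {p : ℝ} (hp : 0 < p)
    (hφ_pos : ∀ t, 0 < t → 0 < φ t)
    (hφ_diff : DifferentiableOn ℝ φ (Ioi 0))
    (hφ₁_zero : Tendsto (fun t => t * φ t) (𝓝[>] 0) (𝓝 0))
    (hφ₁_top : Tendsto (fun t => t * φ t) atTop atTop)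
    (hφ₂ : StrictMonoOn (fun t => t * φ t) (Ioi 0))
    (hφ₃ : ∀ t, 0 < t → p ≤ deriv (fun s => s * φ s) t / φ t) :
    ∃ g, IsFluxInverse g p ∧ (∀ t, g (φ |t| * t) = t) ∧ ∀ s, φ |g s| * g s = s := by
  set h : ℝ → ℝ := fun t => φ |t| * t with hh
  have h_pos : ∀ t, 0 < t → h t = t * φ t := fun t ht => by
    simp only [hh, abs_of_pos ht, mul_comm]
  have h_odd : ∀ t, h (-t) = -h t := fun t => by simp only [hh, abs_neg, mul_neg]
  have h_zero : h 0 = 0 := by simp [hh]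
  have h_posv : ∀ t, 0 < t → 0 < h t := fun t ht => by
    rw [h_pos t ht]
    exact mul_pos ht (hφ_pos t ht)
  have h_mono0 : ∀ a b, 0 ≤ a → a < b → h a < h b := by
    intro a b ha hab
    rcases ha.eq_or_lt with h0 | h0
    · rw [← h0, h_zero]
      exact h_posv b (by linarith)
    · rw [h_pos a h0, h_pos b (h0.trans hab)]
      exact hφ₂ h0 (h0.trans hab : (0 : ℝ) < b) hab
  have h_mono : StrictMono h := by
    intro a b hab
    rcases le_or_gt 0 a with ha | ha
    · exact h_mono0 a b ha hab
    rcases le_or_gt b 0 with hb | hb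
    · have := h_mono0 (-b) (-a) (by linarith) (by linarith)
      rw [h_odd, h_odd] at this
      linarith
    · have h1 := h_posv (-a) (by linarith)
      have h2 := h_posv b hb
      rw [h_odd] at h1
      linarith
  have h_diff : ∀ t, 0 < t → DifferentiableAt ℝ (fun s => s * φ s) t := fun t ht =>
    differentiableAt_id.mul (hφ_diff.differentiableAt (Ioi_mem_nhds ht))
  have h_surj_pos : ∀ s, 0 < s → ∃ t, 0 < t ∧ h t = s := by
    intro s hs
    obtain ⟨a, ha1, ha0⟩ : ∃ a, a * φ a < s ∧ 0 < a :=
      ((hφ₁_zero.eventually (gt_mem_nhds hs)).and self_mem_nhdsWithin).exists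
    obtain ⟨b, hb1, hb0⟩ : ∃ b, s < b * φ b ∧ a < b :=
      ((hφ₁_top.eventually (eventually_gt_atTop s)).and (eventually_gt_atTop a)).exists
    have hc : ContinuousOn (fun t => t * φ t) (Icc a b) := fun t ht =>
      (h_diff t (lt_of_lt_of_le ha0 ht.1)).continuousAt.continuousWithinAt
    obtain ⟨t, ht, hts⟩ := intermediate_value_Icc hb0.le hc ⟨ha1.le, hb1.le⟩
    have ht0 := lt_of_lt_of_le ha0 ht.1
    exact ⟨t, ht0, (h_pos t ht0).trans hts⟩
  have h_surj : Function.Surjective h := by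
    intro s
    rcases lt_trichotomy s 0 with hs | hs | hs
    · obtain ⟨t, -, ht⟩ := h_surj_pos (-s) (by linarith)
      exact ⟨-t, by rw [h_odd, ht, neg_neg]⟩
    · exact ⟨0, by rw [h_zero, hs]⟩
    · obtain ⟨t, -, ht⟩ := h_surj_pos s hs
      exact ⟨t, ht⟩
  let e : ℝ ≃o ℝ := h_mono.orderIsoOfSurjective h h_surj
  have he : ∀ t, e t = h t := fun t => rfl
  have h1 : ∀ s, h (e.symm s) = s := fun s => e.apply_symm_apply s
  have h2 : ∀ t, e.symm (h t) = t := fun t => e.symm_apply_apply t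
  have hodd : ∀ s, e.symm (-s) = -e.symm s := fun s => by
    conv_lhs => rw [← h1 s]
    rw [← h_odd, h2]
  have hsymm_pos : ∀ s, 0 < s → 0 < e.symm s := fun s hs => by
    have := e.symm.strictMono hs
    have h0 := h2 0
    rw [h_zero] at h0
    rwa [h0] at this
  have hratio : MonotoneOn (fun t => t * φ t * t ^ (-p)) (Ioi 0) := by
    have hd : ∀ t, 0 < t → HasDerivAt (fun t => t * φ t * t ^ (-p))
        (deriv (fun s => s * φ s) t * t ^ (-p) + t * φ t * (-p * t ^ (-p - 1))) t := fun t ht =>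
      (h_diff t ht).hasDerivAt.mul (Real.hasDerivAt_rpow_const (Or.inl ht.ne'))
    apply monotoneOn_of_deriv_nonneg (convex_Ioi 0)
    · exact fun t ht => (hd t ht).continuousAt.continuousWithinAt
    · rw [interior_Ioi]
      exact fun t ht => (hd t ht).differentiableAt.differentiableWithinAt
    · rw [interior_Ioi]
      intro t ht
      have ht' : 0 < t := ht
      rw [(hd t ht).deriv]
      have h3 := hφ₃ t ht
      rw [le_div_iff₀ (hφ_pos t ht)] at h3
      have h4 : t * φ t * (-p * t ^ (-p - 1)) = -(p * φ t) * t ^ (-p) := by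
        rw [Real.rpow_sub_one ht'.ne']
        field_simp
      rw [h4, ← add_mul]
      exact mul_nonneg (by linarith) (Real.rpow_nonneg ht'.le _)
  refine ⟨e.symm, ⟨hp, e.symm.continuous, hodd, e.symm.strictMono, ?_⟩, h2, h1⟩
  intro s t hs hst
  have ha := hsymm_pos s hs
  have hb := hsymm_pos t (by linarith)
  have hab : e.symm s ≤ e.symm t := e.symm.monotone hst
  have h3 := hratio (mem_Ioi.2 ha) (mem_Ioi.2 hb) hab
  simp only [← h_pos _ ha, ← h_pos _ hb, h1, Real.rpow_neg ha.le, Real.rpow_neg hb.le] at h3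
  set a := e.symm s
  set b := e.symm t
  have hap : 0 < a ^ p := Real.rpow_pos_of_pos ha p
  have hbp : 0 < b ^ p := Real.rpow_pos_of_pos hb p
  have h4 : (b / a) ^ p ≤ t / s := by
    rw [Real.div_rpow hb.le ha.le, div_le_div_iff₀ hap hs]
    rw [← div_eq_mul_inv, ← div_eq_mul_inv, div_le_div_iff₀ hap hbp] at h3
    linarith
  have h5 : b / a ≤ (t / s) ^ (1 / p) := by
    have h6 := Real.rpow_le_rpow (by positivity) h4 (by positivity : 0 ≤ 1 / p)
    rwa [← Real.rpow_mul (by positivity), mul_one_div_cancel hp.ne', Real.rpow_one] at h6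
  rwa [div_le_iff₀ ha] at h5

/-! ### The first-order system and its energy -/

/-- `(u, y)` solves the first-order system `u' = g(r^(-α) y)`, `y' = -lam r^γ f(u)` on `(0, ∞)`
with `u(0) = d` and `y(0) = 0`. -/
structure IsTrajectory (g f : ℝ → ℝ) (α γ lam d : ℝ) (u y : ℝ → ℝ) : Prop where
  cont_u : ContinuousOn u (Ici 0)
  cont_y : ContinuousOn y (Ici 0)
  u_zero : u 0 = d
  y_zero : y 0 = 0
  deriv_u : ∀ r, 0 < r → HasDerivAt u (g (r ^ (-α) * y r)) r
  deriv_y : ∀ r, 0 < r → HasDerivAt y (-(lam * r ^ γ * f (u r))) r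

/-- Admissible exponents. -/
structure Exponents (α γ p lam : ℝ) : Prop where
  nonneg : 0 ≤ γ
  le : α ≤ γ
  neg_le : -α ≤ γ * p
  lam_pos : 0 < lam

/-- The energy of a trajectory. -/
noncomputable def energy (g f : ℝ → ℝ) (α γ lam : ℝ) (u y : ℝ → ℝ) (r : ℝ) : ℝ :=
  r ^ (α - γ) * primitive g (r ^ (-α) * y r) + lam * primitive f (u r)

theorem hasDerivAt_rpow_succ {γ : ℝ} (hγ : 0 ≤ γ) {x : ℝ} (hx : 0 < x) :
    HasDerivAt (fun r : ℝ => r ^ (γ + 1) / (γ + 1)) (x ^ γ) x := by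
  have h := (Real.hasDerivAt_rpow_const (x := x) (p := γ + 1) (Or.inl hx.ne')).div_const (γ + 1)
  rw [add_sub_cancel_right, mul_div_cancel_left₀ _ (by positivity : γ + 1 ≠ 0)] at h
  exact h

theorem continuous_rpow_succ {γ : ℝ} (hγ : 0 ≤ γ) :
    Continuous (fun r : ℝ => r ^ (γ + 1) / (γ + 1)) :=
  (Real.continuous_rpow_const (by positivity)).div_const _

/-- The primitive of `r ^ γ`, evaluated between `a` and `b`. -/
noncomputable def powerWeight (γ a b : ℝ) : ℝ := b ^ (γ + 1) / (γ + 1) - a ^ (γ + 1) / (γ + 1)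

theorem powerWeight_pos {γ : ℝ} (hγ : 0 ≤ γ) {a b : ℝ} (ha : 0 ≤ a) (hab : a < b) :
    0 < powerWeight γ a b := by
  unfold powerWeight
  rw [← sub_div]
  have := Real.rpow_lt_rpow ha hab (by positivity : 0 < γ + 1)
  exact div_pos (by linarith) (by positivity)

theorem powerWeight_le {γ : ℝ} (hγ : 0 ≤ γ) {a b : ℝ} (ha : 0 ≤ a) (hb : 0 ≤ b) :
    powerWeight γ a b ≤ b ^ (γ + 1) := by
  unfold powerWeight
  have h1 : 0 ≤ a ^ (γ + 1) / (γ + 1) := by positivity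
  have h2 : b ^ (γ + 1) / (γ + 1) ≤ b ^ (γ + 1) := div_le_self (by positivity) (by linarith)
  linarith

namespace IsTrajectory

variable {g f : ℝ → ℝ} {α γ p lam d : ℝ} {u y : ℝ → ℝ}

/-- The reflection (u, y, f) ↦ (-u, -y, -f(-·)) reduces later arguments to one sign of u or of y. -/
theorem neg (hg : IsFluxInverse g p) (h : IsTrajectory g f α γ lam d u y) :
    IsTrajectory g (fun t => -f (-t)) α γ lam (-d) (fun r => -u r) (fun r => -y r) where
  cont_u := h.cont_u.neg
  cont_y := h.cont_y.neg
  u_zero := by rw [h.u_zero]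
  y_zero := by rw [h.y_zero, neg_zero]
  deriv_u r hr := by
    rw [mul_neg, hg.odd]
    exact (h.deriv_u r hr).neg
  deriv_y r hr := by
    simp only [neg_neg, mul_neg]
    have := (h.deriv_y r hr).neg
    rwa [neg_neg] at this

theorem continuousOn_u (h : IsTrajectory g f α γ lam d u y) {a b : ℝ} (ha : 0 ≤ a) :
    ContinuousOn u (Icc a b) := h.cont_u.mono fun _ hx => ha.trans hx.1

theorem continuousOn_y (h : IsTrajectory g f α γ lam d u y) {a b : ℝ} (ha : 0 ≤ a) :
    ContinuousOn y (Icc a b) := h.cont_y.mono fun _ hx => ha.trans hx.1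

theorem flux_le (he : Exponents α γ p lam) (h : IsTrajectory g f α γ lam d u y) {a b K : ℝ}
    (ha : 0 ≤ a) (hab : a ≤ b) (hK : ∀ r ∈ Ioo a b, f (u r) ≤ K) :
    y a - y b ≤ lam * K * powerWeight γ a b := by
  have := sub_le_sub_of_hasDerivAt_le (P := fun r => -y r)
    (P' := fun r => lam * r ^ γ * f (u r)) (Q := fun r => lam * K * (r ^ (γ + 1) / (γ + 1)))
    (Q' := fun r => lam * K * r ^ γ) hab
    (h.continuousOn_y ha).neg (continuous_const.mul (continuous_rpow_succ he.nonneg)).continuousOn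
    (fun x hx => by
      have := (h.deriv_y x (ha.trans_lt hx.1)).neg
      rwa [neg_neg] at this)
    (fun x hx => (hasDerivAt_rpow_succ he.nonneg (ha.trans_lt hx.1)).const_mul _)
    (fun x hx => by
      have h1 : 0 ≤ lam * x ^ γ :=
        mul_nonneg he.lam_pos.le (Real.rpow_nonneg (ha.trans hx.1.le) _)
      nlinarith [mul_le_mul_of_nonneg_left (hK x hx) h1])
  unfold powerWeight
  linarith

theorem le_flux (he : Exponents α γ p lam) (h : IsTrajectory g f α γ lam d u y) {a b K : ℝ}
    (ha : 0 ≤ a) (hab : a ≤ b) (hK : ∀ r ∈ Ioo a b, K ≤ f (u r)) :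
    lam * K * powerWeight γ a b ≤ y a - y b := by
  have := sub_le_sub_of_hasDerivAt_le (Q := fun r => -y r)
    (Q' := fun r => lam * r ^ γ * f (u r)) (P := fun r => lam * K * (r ^ (γ + 1) / (γ + 1)))
    (P' := fun r => lam * K * r ^ γ) hab
    (continuous_const.mul (continuous_rpow_succ he.nonneg)).continuousOn
    (h.continuousOn_y ha).neg
    (fun x hx => (hasDerivAt_rpow_succ he.nonneg (ha.trans_lt hx.1)).const_mul _)
    (fun x hx => by
      have := (h.deriv_y x (ha.trans_lt hx.1)).neg
      rwa [neg_neg] at this)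
    (fun x hx => by
      have h1 : 0 ≤ lam * x ^ γ :=
        mul_nonneg he.lam_pos.le (Real.rpow_nonneg (ha.trans hx.1.le) _)
      nlinarith [mul_le_mul_of_nonneg_left (hK x hx) h1])
  unfold powerWeight
  linarith

theorem abs_flux_le (he : Exponents α γ p lam) (h : IsTrajectory g f α γ lam d u y) {b K : ℝ}
    (hb : 0 ≤ b) (hK : ∀ r ∈ Ioo 0 b, |f (u r)| ≤ K) :
    |y b| ≤ lam * K * powerWeight γ 0 b := by
  have h1 := h.flux_le he le_rfl hb fun r hr => (abs_le.1 (hK r hr)).2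
  have h2 := h.le_flux he le_rfl hb fun r hr => (abs_le.1 (hK r hr)).1
  rw [h.y_zero] at h1 h2
  rw [abs_le]
  constructor <;> linarith

/-- The argument of g carries the factor r^(-α), singular at 0 when α > 0. The exponent γ + 1 - α ≥
1 obtained here shows that it still tends to 0. -/
theorem abs_flux_le_rpow (he : Exponents α γ p lam) (h : IsTrajectory g f α γ lam d u y) {b K : ℝ}
    (hb : 0 < b) (hK : ∀ r ∈ Ioo 0 b, |f (u r)| ≤ K) :
    |b ^ (-α) * y b| ≤ lam * K * b ^ (γ + 1 - α) := by
  have hK0 : 0 ≤ K := (abs_nonneg _).trans (hK (b / 2) ⟨by linarith, by linarith⟩)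
  have h1 := h.abs_flux_le he hb.le hK
  have h2 := powerWeight_le he.nonneg le_rfl hb.le
  have hl := he.lam_pos
  have h3 : 0 < b ^ (-α) := Real.rpow_pos_of_pos hb _
  rw [abs_mul, abs_of_pos h3]
  calc b ^ (-α) * |y b| ≤ b ^ (-α) * (lam * K * b ^ (γ + 1)) := by
        gcongr
        exact h1.trans (by gcongr)
    _ = lam * K * (b ^ (γ + 1) * b ^ (-α)) := by ring
    _ = lam * K * b ^ (γ + 1 - α) := by rw [← Real.rpow_add hb, sub_eq_add_neg]

/-- The weight r^(α-γ) is chosen so that the two terms containing f cancel: r^(α-γ) g(w) r^(-α) λ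
r^γ f(u) = λ f(u) g(w). -/
theorem hasDerivAt_energy (hg : IsFluxInverse g p) (hf : Continuous f)
    (h : IsTrajectory g f α γ lam d u y) {r : ℝ} (hr : 0 < r) :
    HasDerivAt (energy g f α γ lam u y)
      (r ^ (α - γ - 1) * ((α - γ) * primitive g (r ^ (-α) * y r)
        - α * (r ^ (-α) * y r * g (r ^ (-α) * y r)))) r := by
  have hw : HasDerivAt (fun r => r ^ (-α) * y r)
      (-α * r ^ (-α - 1) * y r + r ^ (-α) * (-(lam * r ^ γ * f (u r)))) r :=
    (Real.hasDerivAt_rpow_const (Or.inl hr.ne')).mul (h.deriv_y r hr)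
  have h1 := (Real.hasDerivAt_rpow_const (x := r) (p := α - γ) (Or.inl hr.ne')).mul
    ((hasDerivAt_primitive hg.cont _).comp r hw)
  have h2 := ((hasDerivAt_primitive hf _).comp r (h.deriv_u r hr)).const_mul lam
  refine (h1.add h2).congr_deriv ?_
  rw [Function.comp]
  have hA : 0 < r ^ α := Real.rpow_pos_of_pos hr _
  have hB : 0 < r ^ γ := Real.rpow_pos_of_pos hr _
  set w := r ^ (-α) * y r with hw_def
  have hy : y r = r ^ α * w := by
    rw [hw_def, ← mul_assoc, ← Real.rpow_add hr]
    simp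
  rw [hy, Real.rpow_sub_one hr.ne', Real.rpow_sub_one hr.ne', Real.rpow_sub hr, Real.rpow_neg hr.le]
  field_simp
  ring

theorem energy_antitoneOn (hg : IsFluxInverse g p) (hf : Continuous f)
    (he : Exponents α γ p lam) (h : IsTrajectory g f α γ lam d u y) :
    AntitoneOn (energy g f α γ lam u y) (Ioi 0) := by
  apply antitoneOn_of_deriv_nonpos (convex_Ioi 0)
  · exact fun r hr => (h.hasDerivAt_energy hg hf hr).continuousAt.continuousWithinAt
  · rw [interior_Ioi]
    exact fun r hr => (h.hasDerivAt_energy hg hf hr).differentiableAt.differentiableWithinAt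
  · rw [interior_Ioi]
    intro r hr
    have hr' : 0 < r := hr
    rw [(h.hasDerivAt_energy hg hf hr).deriv]
    set w := r ^ (-α) * y r
    apply mul_nonpos_of_nonneg_of_nonpos (Real.rpow_nonneg hr'.le _)
    have h1 := hg.primitive_nonneg w
    have h2 := hg.mul_self_nonneg w
    have h3 := hg.mul_self_le w
    have hp := hg.p_pos
    have h4 := he.le
    rcases le_total 0 α with ha | ha
    · have := mul_nonneg ha h2
      have := mul_nonneg (sub_nonneg.2 h4) h1
      linarith
    · have h5 : -α * (w * g w) ≤ -α * ((p + 1) / p * primitive g w) :=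
        mul_le_mul_of_nonneg_left h3 (by linarith)
      -- After multiplication by p this is exactly -α ≤ γ p.
      have h6 : -α * ((p + 1) / p) ≤ γ - α := by
        rw [← mul_div_assoc, div_le_iff₀ hp]
        nlinarith [he.neg_le]
      have := mul_le_mul_of_nonneg_right h6 h1
      linarith

/-- The kinetic part is at most r^(α-γ) w g(w) with w = r^(-α) y of order r^(γ+1-α), hence it is of
order r. -/
theorem tendsto_energy (hg : IsFluxInverse g p) (hf : Continuous f)
    (he : Exponents α γ p lam) (h : IsTrajectory g f α γ lam d u y) :
    Tendsto (energy g f α γ lam u y) (𝓝[>] 0) (𝓝 (lam * primitive f d)) := by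
  have hu : Tendsto u (𝓝[>] 0) (𝓝 d) := by
    have := (h.cont_u 0 self_mem_Ici).mono (Ioi_subset_Ici_self)
    rwa [ContinuousWithinAt, h.u_zero] at this
  obtain ⟨K, hK⟩ := isCompact_Icc.exists_bound_of_continuousOn
    (hf.comp_continuousOn (h.continuousOn_u (a := 0) (b := 1) le_rfl))
  have h1 : Tendsto (fun r => lam * primitive f (u r)) (𝓝[>] 0) (𝓝 (lam * primitive f d)) :=
    (((continuous_primitive hf).tendsto d).comp hu).const_mul _
  have hlam := he.lam_pos
  have hK0 : 0 ≤ K := (norm_nonneg _).trans (hK 0 ⟨le_rfl, zero_le_one⟩)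
  have h2 : Tendsto (fun r => r ^ (α - γ) * primitive g (r ^ (-α) * y r)) (𝓝[>] 0) (𝓝 0) := by
    have hlim : Tendsto (fun r : ℝ => r * (lam * K * g (lam * K))) (𝓝[>] 0) (𝓝 0) := by
      have : Tendsto (fun r : ℝ => r * (lam * K * g (lam * K))) (𝓝 0)
          (𝓝 (0 * (lam * K * g (lam * K)))) := (continuous_id.mul continuous_const).tendsto 0
      rw [zero_mul] at this
      exact this.mono_left nhdsWithin_le_nhds
    refine squeeze_zero' ?_ ?_ hlim
    · filter_upwards [self_mem_nhdsWithin] with r hr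
      exact mul_nonneg (Real.rpow_nonneg (le_of_lt hr) _) (hg.primitive_nonneg _)
    · filter_upwards [Ioc_mem_nhdsGT (zero_lt_one (α := ℝ))] with r hr
      have hr0 := hr.1
      have h3 := h.abs_flux_le_rpow he hr.1 (K := K) fun s hs =>
        hK s ⟨hs.1.le, hs.2.le.trans hr.2⟩
      have h4 : r ^ (γ + 1 - α) ≤ 1 :=
        Real.rpow_le_one hr.1.le hr.2 (by linarith [he.le])
      set w := r ^ (-α) * y r
      have h5 : |w| ≤ lam * K := h3.trans (mul_le_of_le_one_right (by positivity) h4)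
      have h6 : |g w| ≤ g (lam * K) := hg.abs_map_le h5
      have h7 : primitive g w ≤ lam * K * r ^ (γ + 1 - α) * g (lam * K) := by
        refine (hg.primitive_le w).trans ((le_abs_self _).trans ?_)
        rw [abs_mul]
        gcongr
      calc r ^ (α - γ) * primitive g w
          ≤ r ^ (α - γ) * (lam * K * r ^ (γ + 1 - α) * g (lam * K)) := by gcongr
        _ = (r ^ (α - γ) * r ^ (γ + 1 - α)) * (lam * K * g (lam * K)) := by ring
        _ = r * (lam * K * g (lam * K)) := by
          rw [← Real.rpow_add hr.1]
          norm_num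
  have := h2.add h1
  rwa [zero_add] at this

theorem energy_le (hg : IsFluxInverse g p) (hf : Continuous f)
    (he : Exponents α γ p lam) (h : IsTrajectory g f α γ lam d u y) {r : ℝ} (hr : 0 < r) :
    energy g f α γ lam u y r ≤ lam * primitive f d := by
  apply ge_of_tendsto (h.tendsto_energy hg hf he)
  filter_upwards [Ioc_mem_nhdsGT hr] with s hs
  exact h.energy_antitoneOn hg hf he hs.1 hr hs.2

/-- Along a trajectory the potential never exceeds its initial value. -/
theorem primitive_le (hg : IsFluxInverse g p) (hf : Continuous f)
    (he : Exponents α γ p lam) (h : IsTrajectory g f α γ lam d u y) {r : ℝ} (hr : 0 ≤ r) :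
    primitive f (u r) ≤ primitive f d := by
  rcases hr.eq_or_lt with h0 | h0
  · rw [← h0, h.u_zero]
  · have h1 := h.energy_le hg hf he h0
    have h2 : 0 ≤ r ^ (α - γ) * primitive g (r ^ (-α) * y r) :=
      mul_nonneg (Real.rpow_nonneg hr _) (hg.primitive_nonneg _)
    unfold energy at h1
    exact le_of_mul_le_mul_left (by linarith) he.lam_pos

end IsTrajectory

theorem primitive_strictMonoOn {f : ℝ → ℝ} (hf : Continuous f) (hpos : ∀ t, t ≠ 0 → 0 < t * f t) :
    StrictMonoOn (primitive f) (Ici 0) := by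
  apply strictMonoOn_of_deriv_pos (convex_Ici 0) (continuous_primitive hf).continuousOn
  rw [interior_Ici]
  intro t ht
  rw [(hasDerivAt_primitive hf t).deriv]
  exact pos_of_mul_pos_right (hpos t (ne_of_gt ht)) (le_of_lt ht)

theorem primitive_strictAntiOn {f : ℝ → ℝ} (hf : Continuous f) (hpos : ∀ t, t ≠ 0 → 0 < t * f t) :
    StrictAntiOn (primitive f) (Iic 0) := by
  apply strictAntiOn_of_deriv_neg (convex_Iic 0) (continuous_primitive hf).continuousOn
  rw [interior_Iic]
  intro t ht
  rw [(hasDerivAt_primitive hf t).deriv]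
  have h1 := hpos t (ne_of_lt ht)
  have h2 : t < 0 := ht
  by_contra hn
  nlinarith

theorem primitive_pos_of_ne {f : ℝ → ℝ} (hf : Continuous f) (hpos : ∀ t, t ≠ 0 → 0 < t * f t)
    {t : ℝ} (ht : t ≠ 0) : 0 < primitive f t := by
  rw [← primitive_zero f]
  rcases lt_or_gt_of_ne ht with h | h
  · exact primitive_strictAntiOn hf hpos h.le (mem_Iic.2 le_rfl) h
  · exact primitive_strictMonoOn hf hpos (mem_Ici.2 le_rfl) h.le h

/-- The relative decay of the energy is at most polynomial: r^C times the energy is nondecreasing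
for large C. Since the energy is positive near 0 it stays positive, whereas it would be 0 if u and y
vanished together. -/
theorem IsTrajectory.ne_zero_or_ne_zero {g f : ℝ → ℝ} {α γ p lam d : ℝ} {u y : ℝ → ℝ}
    (hg : IsFluxInverse g p) (hf : Continuous f) (hpos : ∀ t, t ≠ 0 → 0 < t * f t)
    (he : Exponents α γ p lam) (h : IsTrajectory g f α γ lam d u y) (hd : d ≠ 0) {r : ℝ}
    (hr : 0 ≤ r) : u r ≠ 0 ∨ y r ≠ 0 := by
  rcases hr.eq_or_lt with h0 | h0
  · left
    rwa [← h0, h.u_zero]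
  by_contra! hcon
  have hp := hg.p_pos
  -- This C absorbs both the coefficient α - γ of G and the term α w g(w), the latter through w g(w)
  -- ≤ (p + 1)/p G(w).
  set C := γ - α + |α| * ((p + 1) / p) with hC
  have hd' : ∀ s, 0 < s → HasDerivAt (fun s => s ^ C * energy g f α γ lam u y s)
      (C * s ^ (C - 1) * energy g f α γ lam u y s + s ^ C *
      (s ^ (α - γ - 1) * ((α - γ) * primitive g (s ^ (-α) * y s)
        - α * (s ^ (-α) * y s * g (s ^ (-α) * y s))))) s := fun s hs =>
    (Real.hasDerivAt_rpow_const (Or.inl hs.ne')).mul (h.hasDerivAt_energy hg hf hs)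
  have hC0 : 0 ≤ C := by
    have := he.le
    have : 0 ≤ |α| * ((p + 1) / p) := by positivity
    linarith
  have hmono : MonotoneOn (fun s => s ^ C * energy g f α γ lam u y s) (Ioi 0) := by
    apply monotoneOn_of_deriv_nonneg (convex_Ioi 0)
    · exact fun s hs => (hd' s hs).continuousAt.continuousWithinAt
    · rw [interior_Ioi]
      exact fun s hs => (hd' s hs).differentiableAt.differentiableWithinAt
    · rw [interior_Ioi]
      intro s hs
      have hs' : 0 < s := hs
      rw [(hd' s hs).deriv]
      unfold energy
      set w := s ^ (-α) * y s
      have hF : 0 ≤ primitive f (u s) := by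
        by_cases hu : u s = 0
        · rw [hu, primitive_zero]
        · exact (primitive_pos_of_ne hf hpos hu).le
      have h1 := hg.primitive_nonneg w
      have h2 := hg.mul_self_nonneg w
      have h3 := hg.mul_self_le w
      have h5 : α * (w * g w) ≤ |α| * ((p + 1) / p) * primitive g w := by
        calc α * (w * g w) ≤ |α| * (w * g w) := by
              gcongr
              exact le_abs_self α
          _ ≤ |α| * ((p + 1) / p * primitive g w) := by gcongr
          _ = _ := by ring
      have hCs : 0 < s ^ C := Real.rpow_pos_of_pos hs' _
      have hps : 0 < s ^ (α - γ) := Real.rpow_pos_of_pos hs' _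
      have hlam := he.lam_pos
      rw [Real.rpow_sub_one hs'.ne', Real.rpow_sub_one hs'.ne']
      have key : C * (s ^ C / s) * (s ^ (α - γ) * primitive g w + lam * primitive f (u s)) +
          s ^ C * (s ^ (α - γ) / s * ((α - γ) * primitive g w - α * (w * g w))) =
          s ^ C / s * (C * (lam * primitive f (u s)) + s ^ (α - γ) *
            (|α| * ((p + 1) / p) * primitive g w - α * (w * g w))) := by
        rw [hC]
        field_simp
        ring
      rw [key]
      have h6 : 0 ≤ |α| * ((p + 1) / p) * primitive g w - α * (w * g w) := by linarith
      positivity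
  have hlim := h.tendsto_energy hg hf he
  have hlp : 0 < lam * primitive f d := mul_pos he.lam_pos (primitive_pos_of_ne hf hpos hd)
  obtain ⟨s, hs1, hs2⟩ := ((hlim.eventually (lt_mem_nhds hlp)).and (Ioc_mem_nhdsGT h0)).exists
  have h7 := hmono (mem_Ioi.2 hs2.1) (mem_Ioi.2 h0) hs2.2
  have h8 : energy g f α γ lam u y r = 0 := by
    simp [energy, hcon.1, hcon.2, primitive_zero]
  simp only [h8, mul_zero] at h7
  have h9 : 0 < s ^ C * energy g f α γ lam u y s :=
    mul_pos (Real.rpow_pos_of_pos hs2.1 _) hs1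
  linarith

/-! ### Uniqueness -/

theorem abs_sub_le_of_hasDerivAt {P P' : ℝ → ℝ} {a b K : ℝ} (hab : a ≤ b)
    (hP : ContinuousOn P (Icc a b)) (hP' : ∀ x ∈ Ioo a b, HasDerivAt P (P' x) x)
    (h : ∀ x ∈ Ioo a b, |P' x| ≤ K) : |P b - P a| ≤ K * (b - a) := by
  have hc : ∀ k : ℝ, ContinuousOn (fun x => k * x) (Icc a b) := fun k =>
    (continuous_const.mul continuous_id).continuousOn
  have hd : ∀ k : ℝ, ∀ x ∈ Ioo a b, HasDerivAt (fun x => k * x) k x := fun k x _ => by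
    simpa using (hasDerivAt_id x).const_mul k
  have h1 := sub_le_sub_of_hasDerivAt_le hab hP (hc K) hP' (hd K)
    (fun x hx => (abs_le.1 (h x hx)).2)
  have h2 := sub_le_sub_of_hasDerivAt_le hab (hc (-K)) hP (hd (-K)) hP'
    (fun x hx => (abs_le.1 (h x hx)).1)
  rw [abs_le]
  constructor <;> linarith

/-- A continuous reaction term with the sign of its argument, locally Lipschitz off `0`. -/
structure IsReaction (f : ℝ → ℝ) : Prop where
  cont : Continuous f
  mul_pos : ∀ t, t ≠ 0 → 0 < t * f t
  lip : ∀ t, t ≠ 0 → ∃ L, 0 ≤ L ∧ ∃ ε > 0, ∀ a b, |a - t| < ε → |b - t| < ε →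
    |f a - f b| ≤ L * |a - b|

namespace IsReaction

variable {f : ℝ → ℝ}

theorem neg (hf : IsReaction f) : IsReaction (fun t => -f (-t)) where
  cont := (hf.cont.comp continuous_neg).neg
  mul_pos t ht := by
    have := hf.mul_pos (-t) (neg_ne_zero.2 ht)
    linarith
  lip t ht := by
    obtain ⟨L, hL, ε, hε, h⟩ := hf.lip (-t) (neg_ne_zero.2 ht)
    refine ⟨L, hL, ε, hε, fun a b ha hb => ?_⟩
    have := h (-a) (-b) (by rwa [← neg_sub', abs_neg]) (by rwa [← neg_sub', abs_neg])
    rw [← neg_sub', abs_neg] at this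
    rwa [← neg_sub', abs_neg]

theorem pos (hf : IsReaction f) {t : ℝ} (ht : 0 < t) : 0 < f t :=
  pos_of_mul_pos_right (hf.mul_pos t ht.ne') ht.le

theorem neg_of_neg (hf : IsReaction f) {t : ℝ} (ht : t < 0) : f t < 0 := by
  have := hf.neg.pos (t := -t) (by linarith)
  simp only [neg_neg] at this
  linarith

end IsReaction

namespace IsTrajectory

variable {g f : ℝ → ℝ} {α γ p lam d d' : ℝ} {u₁ y₁ u₂ y₂ : ℝ → ℝ}

theorem flux_sub_le (he : Exponents α γ p lam) (h₁ : IsTrajectory g f α γ lam d u₁ y₁)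
    (h₂ : IsTrajectory g f α γ lam d' u₂ y₂) {a b K : ℝ} (ha : 0 ≤ a) (hab : a ≤ b)
    (hy : y₁ a = y₂ a) (hK : ∀ r ∈ Ioo a b, f (u₁ r) - f (u₂ r) ≤ K) :
    y₂ b - y₁ b ≤ lam * K * powerWeight γ a b := by
  have := sub_le_sub_of_hasDerivAt_le (P := fun r => y₂ r - y₁ r)
    (P' := fun r => -(lam * r ^ γ * f (u₂ r)) - -(lam * r ^ γ * f (u₁ r)))
    (Q := fun r => lam * K * (r ^ (γ + 1) / (γ + 1)))
    (Q' := fun r => lam * K * r ^ γ) hab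
    ((h₂.continuousOn_y ha).sub (h₁.continuousOn_y ha))
    (continuous_const.mul (continuous_rpow_succ he.nonneg)).continuousOn
    (fun x hx => (h₂.deriv_y x (ha.trans_lt hx.1)).sub (h₁.deriv_y x (ha.trans_lt hx.1)))
    (fun x hx => (hasDerivAt_rpow_succ he.nonneg (ha.trans_lt hx.1)).const_mul _)
    (fun x hx => by
      have h1 : 0 ≤ lam * x ^ γ :=
        mul_nonneg he.lam_pos.le (Real.rpow_nonneg (ha.trans hx.1.le) _)
      nlinarith [mul_le_mul_of_nonneg_left (hK x hx) h1])
  unfold powerWeight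
  linarith

theorem flux_eq (he : Exponents α γ p lam) (h₁ : IsTrajectory g f α γ lam d u₁ y₁)
    (h₂ : IsTrajectory g f α γ lam d' u₂ y₂) {a b : ℝ} (ha : 0 ≤ a) (hab : a ≤ b)
    (hy : y₁ a = y₂ a) (hu : ∀ r ∈ Ioo a b, u₁ r = u₂ r) : y₁ b = y₂ b := by
  have h3 := h₁.flux_sub_le he h₂ (K := 0) ha hab hy fun r hr => by rw [hu r hr, sub_self]
  have h4 := h₂.flux_sub_le he h₁ (K := 0) ha hab hy.symm fun r hr => by rw [hu r hr, sub_self]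
  simp only [mul_zero, zero_mul] at h3 h4
  linarith

theorem eventually_ge (h : IsTrajectory g f α γ lam d u₁ y₁) {x : ℝ} (hx : 0 ≤ x)
    {s : Set ℝ} (hs : s ∈ 𝓝 (u₁ x)) : ∀ᶠ r in 𝓝[≥] x, u₁ r ∈ s :=
  ((h.cont_u x hx).mono (Ici_subset_Ici.2 hx)).eventually hs

/-- Local uniqueness to the right of a positive critical point. -/
theorem unique_right_of_flux_eq_zero (hg : IsFluxInverse g p) (hf : IsReaction f)
    (he : Exponents α γ p lam) (h₁ : IsTrajectory g f α γ lam d u₁ y₁)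
    (h₂ : IsTrajectory g f α γ lam d' u₂ y₂) {x : ℝ} (hx : 0 ≤ x) (hu : u₁ x = u₂ x)
    (hy₁ : y₁ x = 0) (hy₂ : y₂ x = 0) (hpos : 0 < u₁ x) :
    ∃ δ > 0, ∀ r ∈ Icc x (x + δ), u₁ r = u₂ r := by
  obtain ⟨L, hL, ε, hε, hLip⟩ := hf.lip (u₁ x) hpos.ne'
  have hp := hg.p_pos
  have hlam := he.lam_pos
  -- Near x both f(u₁) and f(u₂) lie between c and K, so both fluxes lie between multiples of the
  -- same weight.
  set c := f (u₁ x) / 2 with hc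
  set K := 2 * f (u₁ x) with hK
  have hfu : 0 < f (u₁ x) := hf.pos hpos
  have hc0 : 0 < c := by positivity
  have hnear : ∀ᶠ t in 𝓝 (u₁ x), |t - u₁ x| < ε ∧ |t - u₁ x| < 1 / 2 ∧ c < f t ∧ f t < K :=
    (eventually_abs_sub_lt _ hε).and ((eventually_abs_sub_lt _ (by norm_num)).and
      ((hf.cont.continuousAt.eventually (lt_mem_nhds (by linarith))).and
        (hf.cont.continuousAt.eventually (gt_mem_nhds (by linarith)))))
  have hnear₂ : ∀ᶠ t in 𝓝 (u₂ x), |t - u₁ x| < ε ∧ |t - u₁ x| < 1 / 2 ∧ c < f t ∧ f t < K := by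
    rw [← hu]
    exact hnear
  obtain ⟨b, hxb, hb⟩ := mem_nhdsGE_iff_exists_Icc_subset.1
    ((h₁.eventually_ge hx hnear).and (h₂.eventually_ge hx hnear₂))
  have hxb' : x < b := hxb
  set G := g (lam * K * (x + 1) ^ (γ + 1 - α)) with hG
  have hκ : 0 ≤ γ + 1 - α := by linarith [he.le]
  have hG0 : 0 < G := hg.pos (by
    have : 0 < (x + 1) ^ (γ + 1 - α) := Real.rpow_pos_of_pos (by linarith) _
    positivity)
  set C := L / c / p * Real.exp (L / c / p) * G with hC
  have hC0 : 0 ≤ C := by positivity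
  -- The three bounds keep r in the good neighbourhood, give r ≤ x + 1, and make C δ < 1, so that
  -- the final estimate m ≤ C δ m is a contraction.
  set δ := min (b - x) (min 1 (1 / (2 * (C + 1)))) with hδ
  have hδ0 : 0 < δ := lt_min (by linarith) (lt_min one_pos (by positivity))
  have hδb : x + δ ≤ b := by linarith [min_le_left (b - x) (min 1 (1 / (2 * (C + 1))))]
  have hδ1 : δ ≤ 1 := (min_le_right _ _).trans (min_le_left _ _)
  have hCδ : C * δ < 1 := by
    have h3 : δ ≤ 1 / (2 * (C + 1)) := (min_le_right _ _).trans (min_le_right _ _)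
    calc C * δ ≤ C * (1 / (2 * (C + 1))) := by gcongr
      _ < 1 := by
        rw [mul_one_div, div_lt_one (by positivity)]
        linarith
  have hcont : ContinuousOn (fun r => u₁ r - u₂ r) (Icc x (x + δ)) :=
    (h₁.continuousOn_u hx).sub (h₂.continuousOn_u hx)
  obtain ⟨s, hs, hmax⟩ := isCompact_Icc.exists_isMaxOn (nonempty_Icc.2 (by linarith)) hcont.abs
  set m := |u₁ s - u₂ s| with hm
  have hm0 : 0 ≤ m := abs_nonneg _
  have hle : ∀ r ∈ Icc x (x + δ), |u₁ r - u₂ r| ≤ m := fun r hr => hmax hr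
  have hin : ∀ r ∈ Icc x (x + δ), _ := fun r hr => hb ⟨hr.1, hr.2.trans hδb⟩
  have hm1 : m ≤ 1 := by
    have h3 := (hin s hs).1.2.1
    have h4 := (hin s hs).2.2.1
    rw [abs_lt] at h3 h4
    rw [hm, abs_le]
    constructor <;> linarith
  have hderiv : ∀ r ∈ Ioo x s, |g (r ^ (-α) * y₁ r) - g (r ^ (-α) * y₂ r)| ≤ C * m := by
    intro r hr
    have hr0 : 0 < r := hx.trans_lt hr.1
    have hrs : r ≤ x + δ := hr.2.le.trans hs.2
    set A := powerWeight γ x r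
    have hA : 0 < A := powerWeight_pos he.nonneg hx hr.1
    have hsub : ∀ q ∈ Ioo x r, q ∈ Icc x (x + δ) := fun q hq => ⟨hq.1.le, hq.2.le.trans hrs⟩
    have a1 := h₁.le_flux he hx hr.1.le fun q hq => (hin q (hsub q hq)).1.2.2.1.le
    have a2 := h₂.le_flux he hx hr.1.le fun q hq => (hin q (hsub q hq)).2.2.2.1.le
    have b1 := h₁.flux_le he hx hr.1.le fun q hq => (hin q (hsub q hq)).1.2.2.2.le
    have b2 := h₂.flux_le he hx hr.1.le fun q hq => (hin q (hsub q hq)).2.2.2.2.le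
    have hLm : ∀ q ∈ Ioo x r, |f (u₁ q) - f (u₂ q)| ≤ L * m := fun q hq => by
      have h3 := hin q (hsub q hq)
      exact (hLip _ _ h3.1.1 h3.2.1).trans
        (mul_le_mul_of_nonneg_left (hle q (hsub q hq)) hL)
    have c1 := h₁.flux_sub_le he h₂ hx hr.1.le (hy₁.trans hy₂.symm)
      fun q hq => (abs_le.1 (hLm q hq)).2
    have c2 := h₂.flux_sub_le he h₁ hx hr.1.le (hy₂.trans hy₁.symm) (K := L * m)
      fun q hq => by linarith [(abs_le.1 (hLm q hq)).1]
    rw [hy₁, zero_sub] at a1 b1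
    rw [hy₂, zero_sub] at a2 b2
    have hrα : 0 < r ^ (-α) := Real.rpow_pos_of_pos hr0 _
    have key : ∀ P Q : ℝ, lam * c * A ≤ Q → Q ≤ lam * K * A → Q ≤ P →
        P - Q ≤ lam * (L * m) * A →
        |g (r ^ (-α) * P) - g (r ^ (-α) * Q)| ≤ C * m := by
      intro P Q hQ1 hQ2 hPQ hd
      have hQ : 0 < Q := lt_of_lt_of_le (by positivity) hQ1
      have h3 : r ^ (-α) * Q ≤ r ^ (-α) * P := by gcongr
      rw [abs_of_nonneg (by linarith [hg.mono.monotone h3])]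
      -- P - Q ≤ λ L m A and Q ≥ λ c A, so the relative variation is at most L m / c. The weight A,
      -- which vanishes at x, drops out.
      have h4 := hg.sub_le (a := L * m / c) (a₀ := L / c) (by positivity) h3
        (by
          rw [← mul_sub]
          calc r ^ (-α) * (P - Q) ≤ r ^ (-α) * (lam * (L * m) * A) := by gcongr
            _ = r ^ (-α) * (L * m / c * (lam * c * A)) := by field_simp
            _ ≤ r ^ (-α) * (L * m / c * Q) := by gcongr
            _ = L * m / c * (r ^ (-α) * Q) := by ring)
        (by
          gcongr
          exact mul_le_of_le_one_right hL hm1)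
      have h5 : g (r ^ (-α) * Q) ≤ G := by
        apply hg.mono.monotone
        calc r ^ (-α) * Q ≤ r ^ (-α) * (lam * K * r ^ (γ + 1)) := by
              gcongr
              refine hQ2.trans ?_
              gcongr
              exact powerWeight_le he.nonneg hx hr0.le
          _ = lam * K * (r ^ (γ + 1) * r ^ (-α)) := by ring
          _ = lam * K * r ^ (γ + 1 - α) := by rw [← Real.rpow_add hr0, sub_eq_add_neg]
          _ ≤ lam * K * (x + 1) ^ (γ + 1 - α) := by
            gcongr
            linarith
      calc _ ≤ L * m / c / p * Real.exp (L / c / p) * g (r ^ (-α) * Q) := h4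
        _ ≤ L * m / c / p * Real.exp (L / c / p) * G := by gcongr
        _ = C * m := by
          rw [hC]
          ring
    have hflip : |g (r ^ (-α) * y₁ r) - g (r ^ (-α) * y₂ r)| =
        |g (r ^ (-α) * -y₁ r) - g (r ^ (-α) * -y₂ r)| := by
      rw [mul_neg, mul_neg, hg.odd, hg.odd, ← neg_sub', abs_neg]
    rw [hflip]
    rcases le_total (-y₂ r) (-y₁ r) with h | h
    · exact key _ _ a2 b2 h (by linarith)
    · rw [abs_sub_comm]
      exact key _ _ a1 b1 h (by linarith)
  have hfin := abs_sub_le_of_hasDerivAt hs.1 (hcont.mono (Icc_subset_Icc_right hs.2))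
    (fun r hr => (h₁.deriv_u r (hx.trans_lt hr.1)).sub (h₂.deriv_u r (hx.trans_lt hr.1))) hderiv
  rw [hu, sub_self, sub_zero] at hfin
  have hms : m ≤ C * δ * m := by
    calc m ≤ C * m * (s - x) := hfin
      _ ≤ C * m * δ := by
        gcongr
        linarith [hs.2]
      _ = C * δ * m := by ring
  have hmz : m = 0 := by nlinarith
  refine ⟨δ, hδ0, fun r hr => ?_⟩
  have := hle r hr
  rw [hmz] at this
  exact sub_eq_zero.1 (abs_nonpos_iff.1 this)

/-- Local uniqueness to the right of a point with negative flux. -/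
theorem unique_right_of_flux_neg (hg : IsFluxInverse g p) (hf : IsReaction f)
    (he : Exponents α γ p lam) (h₁ : IsTrajectory g f α γ lam d u₁ y₁)
    (h₂ : IsTrajectory g f α γ lam d' u₂ y₂) {x : ℝ} (hx : 0 < x) (hu : u₁ x = u₂ x)
    (hy : y₁ x = y₂ x) (hneg : y₁ x < 0) :
    ∃ δ > 0, ∀ r ∈ Icc x (x + δ), u₁ r = u₂ r := by
  have hp := hg.p_pos
  have hlam := he.lam_pos
  set v₁ := fun r => -(r ^ (-α) * y₁ r) with hv₁
  set v₂ := fun r => -(r ^ (-α) * y₂ r) with hv₂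
  have hv0 : 0 < v₁ x := by
    have : 0 < x ^ (-α) := Real.rpow_pos_of_pos hx _
    simp only [hv₁]
    nlinarith
  have hvx : v₂ x = v₁ x := by simp only [hv₁, hv₂, hy]
  set c := v₁ x / 2 with hc
  set K := 2 * v₁ x with hK
  have hc0 : 0 < c := by positivity
  have hpc : ContinuousAt (fun r : ℝ => r ^ (-α)) x :=
    Real.continuousAt_rpow_const _ _ (Or.inl hx.ne')
  have hvc₁ : ContinuousAt v₁ x := (hpc.mul (h₁.deriv_y x hx).continuousAt).neg
  have hvc₂ : ContinuousAt v₂ x := (hpc.mul (h₂.deriv_y x hx).continuousAt).neg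
  have hvn : ∀ v : ℝ → ℝ, ContinuousAt v x → v x = v₁ x → ∀ᶠ r in 𝓝 x, v r ∈ Icc c K :=
    fun v hv h => hv.eventually (Icc_mem_nhds (by linarith) (by linarith))
  have hun : ∀ᶠ t in 𝓝 (u₁ x), t ∈ Icc (u₁ x - 1) (u₁ x + 1) :=
    Icc_mem_nhds (by linarith) (by linarith)
  have hun₂ : ∀ᶠ t in 𝓝 (u₂ x), t ∈ Icc (u₁ x - 1) (u₁ x + 1) := by
    rw [← hu]
    exact hun
  obtain ⟨b, hxb, hb⟩ := mem_nhdsGE_iff_exists_Icc_subset.1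
    (((h₁.eventually_ge hx.le hun).and (h₂.eventually_ge hx.le hun₂)).and
      (((hvn v₁ hvc₁ rfl).and (hvn v₂ hvc₂ hvx)).filter_mono nhdsWithin_le_nhds))
  clear_value v₁ v₂
  have hxb' : x < b := hxb
  obtain ⟨M, hM⟩ := isCompact_Icc.exists_bound_of_continuousOn
    (hf.cont.continuousOn (s := Icc (u₁ x - 1) (u₁ x + 1)))
  have hM0 : 0 ≤ M := (norm_nonneg _).trans (hM (u₁ x) ⟨by linarith, by linarith⟩)
  -- F is Lipschitz because f is bounded here; no regularity of f is needed, so u may vanish at x.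
  have hFlip : ∀ s t, s ∈ Icc (u₁ x - 1) (u₁ x + 1) → t ∈ Icc (u₁ x - 1) (u₁ x + 1) →
      |primitive f t - primitive f s| ≤ M * |t - s| := by
    intro s t hs ht
    wlog hst : s ≤ t generalizing s t
    · rw [abs_sub_comm, abs_sub_comm t]
      exact this t s ht hs (le_of_not_ge hst)
    rw [abs_of_nonneg (sub_nonneg.2 hst)]
    exact abs_sub_le_of_hasDerivAt hst (continuous_primitive hf.cont).continuousOn
      (fun q _ => hasDerivAt_primitive hf.cont q)
      (fun q hq => hM q ⟨hs.1.trans hq.1.le, hq.2.le.trans ht.2⟩)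
  -- On [c, K] the slope of G lies between g(c) > 0 and g(K), so G is bi-Lipschitz and the flux can
  -- be recovered from the energy.
  have hHlip : ∀ s t, s ∈ Icc c K → t ∈ Icc c K →
      |primitive g t - primitive g s| ≤ g K * |t - s| ∧
      g c * |t - s| ≤ |primitive g t - primitive g s| := by
    intro s t hs ht
    wlog hst : s ≤ t generalizing s t
    · rw [abs_sub_comm, abs_sub_comm t]
      exact this t s ht hs (le_of_not_ge hst)
    rw [abs_of_nonneg (sub_nonneg.2 hst)]
    constructor
    · exact abs_sub_le_of_hasDerivAt hst (continuous_primitive hg.cont).continuousOn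
        (fun q _ => hasDerivAt_primitive hg.cont q)
        (fun q hq => by
          apply hg.abs_map_le
          rw [abs_of_pos (hc0.trans_le (hs.1.trans hq.1.le))]
          exact hq.2.le.trans ht.2)
    · have := sub_le_sub_of_hasDerivAt_le (P := fun q => g c * q) (P' := fun _ => g c) hst
        (continuous_const.mul continuous_id).continuousOn
        (continuous_primitive hg.cont).continuousOn
        (fun q _ => by simpa using (hasDerivAt_id q).const_mul (g c))
        (fun q _ => hasDerivAt_primitive hg.cont q)
        (fun q hq => hg.mono.monotone (hs.1.trans hq.1.le))
      refine le_trans ?_ (le_abs_self _)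
      linarith
  set C₁ := 1 / (c * p) * Real.exp (K / c / p) * g K with hC₁
  have hgc : 0 < g c := hg.pos hc0
  have hgK : 0 < g K := hg.pos (by positivity)
  set C₂ := x ^ (α - γ - 1) * (|α - γ| * g K + |α| * (K * C₁ + g K)) with hC₂
  set C₃ := (x + 1) ^ (γ - α) * (1 + lam * M) / g c with hC₃
  have hxp : 0 < x ^ (α - γ - 1) := Real.rpow_pos_of_pos hx _
  have hxp1 : 0 < (x + 1) ^ (γ - α) := Real.rpow_pos_of_pos (by linarith) _
  have hC₁0 : 0 ≤ C₁ := by positivity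
  have hC₂0 : 0 ≤ C₂ := by positivity
  have hC₃0 : 0 ≤ C₃ := by positivity
  set δ := min (b - x) 1 with hδ
  have hδ0 : 0 < δ := lt_min (by linarith) one_pos
  have hδb : x + δ ≤ b := by linarith [min_le_left (b - x) 1]
  have hδ1 : δ ≤ 1 := min_le_right _ _
  set E₁ := energy g f α γ lam u₁ y₁ with hE₁
  set E₂ := energy g f α γ lam u₂ y₂ with hE₂
  -- Grönwall is applied to (u, energy) instead of (u, y): the derivative of y contains f(u), which
  -- need not be Lipschitz in u, while that of the energy involves only r and v.
  set V : ℝ → ℝ × ℝ := fun r => (u₁ r - u₂ r, E₁ r - E₂ r) with hV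
  have hVd : ∀ r, 0 < r → HasDerivAt V
      (g (r ^ (-α) * y₁ r) - g (r ^ (-α) * y₂ r),
       r ^ (α - γ - 1) * ((α - γ) * primitive g (r ^ (-α) * y₁ r)
        - α * (r ^ (-α) * y₁ r * g (r ^ (-α) * y₁ r))) -
       r ^ (α - γ - 1) * ((α - γ) * primitive g (r ^ (-α) * y₂ r)
        - α * (r ^ (-α) * y₂ r * g (r ^ (-α) * y₂ r)))) r := fun r hr =>
    ((h₁.deriv_u r hr).sub (h₂.deriv_u r hr)).prodMk
      ((h₁.hasDerivAt_energy hg hf.cont hr).sub (h₂.hasDerivAt_energy hg hf.cont hr))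
  have hVx : V x = 0 := by
    simp only [hV, hE₁, hE₂, energy, hu, hy, sub_self]
    rfl
  have main := norm_le_gronwallBound_of_norm_deriv_right_le (f := V) (δ := 0) (ε := 0)
    (K := max C₁ C₂ * C₃) (a := x) (b := x + δ)
    (fun r hr => (hVd r (hx.trans_le hr.1)).continuousAt.continuousWithinAt)
    (fun r hr => (hVd r (hx.trans_le hr.1)).hasDerivWithinAt) (by rw [hVx, norm_zero])
    (by
      intro r hr
      have hr0 : 0 < r := hx.trans_le hr.1
      obtain ⟨⟨m1, m2⟩, m3, m4⟩ := hb ⟨hr.1, hr.2.le.trans hδb⟩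
      have e1 : r ^ (-α) * y₁ r = -v₁ r := by simp only [hv₁, neg_neg]
      have e2 : r ^ (-α) * y₂ r = -v₂ r := by simp only [hv₂, neg_neg]
      set N := ‖V r‖ with hN
      have n1 : |u₁ r - u₂ r| ≤ N := norm_fst_le (V r)
      have n2 : |E₁ r - E₂ r| ≤ N := norm_snd_le (V r)
      have hN0 : 0 ≤ N := norm_nonneg _
      have hve : primitive g (v₁ r) - primitive g (v₂ r) =
          r ^ (γ - α) * ((E₁ r - E₂ r) - lam * (primitive f (u₁ r) - primitive f (u₂ r))) := by
        simp only [hE₁, hE₂, energy, e1, e2, hg.primitive_neg]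
        have h3 : r ^ (γ - α) * r ^ (α - γ) = 1 := by
          rw [← Real.rpow_add hr0]
          norm_num
        linear_combination (-(primitive g (v₁ r) - primitive g (v₂ r))) * h3
      have hrp : r ^ (γ - α) ≤ (x + 1) ^ (γ - α) := by
        apply Real.rpow_le_rpow hr0.le _ (by linarith [he.le])
        linarith [hr.2]
      have hrp0 : 0 < r ^ (γ - α) := Real.rpow_pos_of_pos hr0 _
      have hv : |v₁ r - v₂ r| ≤ C₃ * N := by
        have h3 := (hHlip _ _ m4 m3).2
        have h4 := hFlip _ _ m2 m1
        rw [hC₃, div_mul_eq_mul_div, le_div_iff₀ hgc, mul_comm]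
        refine h3.trans ?_
        rw [hve, abs_mul, abs_of_pos hrp0, mul_assoc]
        gcongr
        calc _ ≤ |E₁ r - E₂ r| + |lam * (primitive f (u₁ r) - primitive f (u₂ r))| := abs_sub _ _
          _ ≤ N + lam * (M * N) := by
            rw [abs_mul, abs_of_pos hlam]
            gcongr
            exact h4.trans (by gcongr)
          _ = (1 + lam * M) * N := by ring
      have hgl : |g (v₁ r) - g (v₂ r)| ≤ C₁ * |v₁ r - v₂ r| := hg.abs_sub_le_of_le hc0 m4 m3
      have hvg : |v₁ r * g (v₁ r) - v₂ r * g (v₂ r)| ≤ (K * C₁ + g K) * |v₁ r - v₂ r| := by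
        have h3 : v₁ r * g (v₁ r) - v₂ r * g (v₂ r) =
          v₁ r * (g (v₁ r) - g (v₂ r)) + (v₁ r - v₂ r) * g (v₂ r) := by ring
        rw [h3]
        refine (abs_add_le _ _).trans ?_
        rw [abs_mul, abs_mul, add_mul]
        have h5 : |v₁ r| ≤ K := by
          rw [abs_of_pos (hc0.trans_le m3.1)]
          exact m3.2
        have h6 : |g (v₂ r)| ≤ g K := hg.abs_map_le (by
          rw [abs_of_pos (hc0.trans_le m4.1)]
          exact m4.2)
        have h7 : |v₁ r| * |g (v₁ r) - g (v₂ r)| ≤ K * (C₁ * |v₁ r - v₂ r|) := by gcongr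
        have h8 : |v₁ r - v₂ r| * |g (v₂ r)| ≤ |v₁ r - v₂ r| * g K := by gcongr
        linarith
      have hmax : max C₁ C₂ * |v₁ r - v₂ r| ≤ max C₁ C₂ * C₃ * N := by
        rw [mul_assoc]
        exact mul_le_mul_of_nonneg_left hv (hC₁0.trans (le_max_left _ _))
      rw [add_zero]
      refine le_trans ?_ hmax
      rw [e1, e2, hg.primitive_neg, hg.primitive_neg, hg.mul_neg_self, hg.mul_neg_self, hg.odd,
        hg.odd, Prod.norm_def]
      apply max_le
      · rw [Real.norm_eq_abs, ← neg_sub', abs_neg]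
        refine hgl.trans ?_
        gcongr
        exact le_max_left _ _
      · rw [Real.norm_eq_abs, ← mul_sub, abs_mul, abs_of_pos (Real.rpow_pos_of_pos hr0 _)]
        have h9 : r ^ (α - γ - 1) ≤ x ^ (α - γ - 1) :=
          Real.rpow_le_rpow_of_nonpos hx hr.1 (by linarith [he.le])
        have h10 : (α - γ) * primitive g (v₁ r) - α * (v₁ r * g (v₁ r)) -
            ((α - γ) * primitive g (v₂ r) - α * (v₂ r * g (v₂ r))) =
            (α - γ) * (primitive g (v₁ r) - primitive g (v₂ r)) -
            α * (v₁ r * g (v₁ r) - v₂ r * g (v₂ r)) := by ring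
        rw [h10]
        have h11 : |(α - γ) * (primitive g (v₁ r) - primitive g (v₂ r)) -
            α * (v₁ r * g (v₁ r) - v₂ r * g (v₂ r))| ≤
            (|α - γ| * g K + |α| * (K * C₁ + g K)) * |v₁ r - v₂ r| := by
          refine (abs_sub _ _).trans ?_
          rw [abs_mul, abs_mul, add_mul, mul_assoc, mul_assoc]
          gcongr
          exact (hHlip _ _ m4 m3).1
        calc _ ≤ x ^ (α - γ - 1) *
              ((|α - γ| * g K + |α| * (K * C₁ + g K)) * |v₁ r - v₂ r|) := by gcongr
          _ = C₂ * |v₁ r - v₂ r| := by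
            rw [hC₂]
            ring
          _ ≤ _ := by
            gcongr
            exact le_max_right _ _)
  refine ⟨δ, hδ0, fun r hr => ?_⟩
  have h3 := main r hr
  rw [gronwallBound_ε0_δ0] at h3
  exact sub_eq_zero.1 (abs_nonpos_iff.1 ((norm_fst_le (V r)).trans h3))

/-- Since u and y never vanish together, each point is either a critical point with u ≠ 0 or a point
with y ≠ 0. Reflection fixes the sign. -/
theorem unique_right (hg : IsFluxInverse g p) (hf : IsReaction f)
    (he : Exponents α γ p lam) (h₁ : IsTrajectory g f α γ lam d u₁ y₁)
    (h₂ : IsTrajectory g f α γ lam d u₂ y₂) (hd : d ≠ 0) {x : ℝ} (hx : 0 ≤ x)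
    (hu : u₁ x = u₂ x) (hy : y₁ x = y₂ x) :
    ∃ δ > 0, ∀ r ∈ Icc x (x + δ), u₁ r = u₂ r := by
  by_cases hy0 : y₁ x = 0
  · have hux : u₁ x ≠ 0 := by
      have := h₁.ne_zero_or_ne_zero hg hf.cont hf.mul_pos he hd hx
      tauto
    rcases lt_or_gt_of_ne hux with h | h
    · obtain ⟨δ, hδ, hr⟩ := (h₁.neg hg).unique_right_of_flux_eq_zero hg hf.neg he (h₂.neg hg) hx
        (by rw [hu]) (by rw [hy0, neg_zero]) (by rw [← hy, hy0, neg_zero]) (by linarith)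
      exact ⟨δ, hδ, fun r hr' => neg_injective (hr r hr')⟩
    · exact h₁.unique_right_of_flux_eq_zero hg hf he h₂ hx hu hy0 (hy ▸ hy0) h
  · have hx0 : 0 < x := by
      refine lt_of_le_of_ne hx fun h => hy0 ?_
      rw [← h, h₁.y_zero]
    rcases lt_or_gt_of_ne hy0 with h | h
    · exact h₁.unique_right_of_flux_neg hg hf he h₂ hx0 hu hy h
    · obtain ⟨δ, hδ, hr⟩ := (h₁.neg hg).unique_right_of_flux_neg hg hf.neg he (h₂.neg hg) hx0
        (by rw [hu]) (by rw [hy]) (by linarith)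
      exact ⟨δ, hδ, fun r hr' => neg_injective (hr r hr')⟩

/-- Uniqueness of trajectories with nonzero initial value. -/
theorem unique (hg : IsFluxInverse g p) (hf : IsReaction f)
    (he : Exponents α γ p lam) (h₁ : IsTrajectory g f α γ lam d u₁ y₁)
    (h₂ : IsTrajectory g f α γ lam d u₂ y₂) (hd : d ≠ 0) : EqOn u₁ u₂ (Ici 0) := by
  intro b hb
  -- The set records agreement of u and of y, since both are needed to restart the local result. It
  -- is closed, and the local result extends it to the right.
  set s : Set ℝ := {r | u₁ r = u₂ r ∧ y₁ r = y₂ r} with hs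
  have hclosed : IsClosed (s ∩ Icc 0 b) := by
    have hc : ContinuousOn (fun r => (u₁ r - u₂ r, y₁ r - y₂ r)) (Icc 0 b) :=
      ((h₁.continuousOn_u le_rfl).sub (h₂.continuousOn_u le_rfl)).prodMk
        ((h₁.continuousOn_y le_rfl).sub (h₂.continuousOn_y le_rfl))
    have := hc.preimage_isClosed_of_isClosed isClosed_Icc (isClosed_singleton (x := (0, 0)))
    convert this using 1
    ext r
    simp [hs, sub_eq_zero, and_comm]
  have hsub := hclosed.Icc_subset_of_forall_exists_gt (a := 0) (b := b)
    ⟨h₁.u_zero.trans h₂.u_zero.symm, h₁.y_zero.trans h₂.y_zero.symm⟩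
    (by
      rintro x ⟨⟨hxu, hxy⟩, hxI⟩ z hz
      obtain ⟨δ, hδ, hr⟩ := h₁.unique_right hg hf he h₂ hd hxI.1 hxu hxy
      have hz' : x < z := hz
      have hle : x ≤ min z (x + δ) := le_min hz'.le (by linarith)
      refine ⟨min z (x + δ), ⟨hr _ ⟨hle, min_le_right _ _⟩, ?_⟩,
        lt_min hz' (by linarith), min_le_left _ _⟩
      exact h₁.flux_eq he h₂ hxI.1 hle hxy fun q hq =>
        hr q ⟨hq.1.le, hq.2.le.trans (min_le_right _ _)⟩)
  exact (hsub ⟨hb, le_rfl⟩).1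

end IsTrajectory

/-! ### Existence through a delayed integral equation -/

/-- The rescaled flux `r^(-α) y(r)` produced by `v`, where `v` is read with a delay `ε` and
`κ = γ + 1 - α`. -/
noncomputable def delayedFlux (f : ℝ → ℝ) (κ γ lam ε : ℝ) (v : ℝ → ℝ) (s : ℝ) : ℝ :=
  -(lam * max s 0 ^ κ * ∫ τ in (0 : ℝ)..1, τ ^ γ * f (v (max s 0 * τ - ε)))

/-- The integral operator of the initial value problem with delay `ε`. -/
noncomputable def delayedPicard (g f : ℝ → ℝ) (κ γ lam ε d : ℝ) (v : ℝ → ℝ) (r : ℝ) : ℝ :=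
  d + ∫ s in (0 : ℝ)..r, g (delayedFlux f κ γ lam ε v s)

/-- Hypotheses on the data under which the integral operator is well behaved. -/
structure PicardData (g f : ℝ → ℝ) (p κ γ lam M : ℝ) : Prop where
  inv : IsFluxInverse g p
  cont : Continuous f
  bound : ∀ t, |f t| ≤ M
  κ_pos : 0 < κ
  nonneg : 0 ≤ γ
  lam_nonneg : 0 ≤ lam

namespace PicardData

variable {g f : ℝ → ℝ} {p κ γ lam M : ℝ}

theorem continuous_integrand (h : PicardData g f p κ γ lam M) {v : ℝ → ℝ} (hv : Continuous v)
    (ε s : ℝ) : Continuous fun τ : ℝ => τ ^ γ * f (v (max s 0 * τ - ε)) := by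
  have h1 : Continuous fun τ : ℝ => τ ^ γ := Real.continuous_rpow_const h.nonneg
  have h2 := h.cont
  fun_prop

theorem abs_integrand_le (h : PicardData g f p κ γ lam M) {τ : ℝ} (hτ : τ ∈ uIoc (0 : ℝ) 1) (t : ℝ) :
    |τ ^ γ * f t| ≤ M := by
  rw [uIoc_of_le zero_le_one] at hτ
  rw [abs_mul, abs_of_nonneg (Real.rpow_nonneg hτ.1.le _)]
  have h1 : τ ^ γ ≤ 1 := Real.rpow_le_one hτ.1.le hτ.2 h.nonneg
  calc τ ^ γ * |f t| ≤ 1 * M := by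
        gcongr
        exact h.bound t
    _ = M := one_mul M

theorem continuous_delayedFlux (h : PicardData g f p κ γ lam M) {v : ℝ → ℝ} (hv : Continuous v)
    (ε : ℝ) : Continuous (delayedFlux f κ γ lam ε v) := by
  have h1 : Continuous fun τ : ℝ => τ ^ γ := Real.continuous_rpow_const h.nonneg
  have h2 := h.cont
  have h3 : Continuous fun s : ℝ => ∫ τ in (0 : ℝ)..1, τ ^ γ * f (v (max s 0 * τ - ε)) := by
    apply intervalIntegral.continuous_parametric_intervalIntegral_of_continuous'
    unfold Function.uncurry
    fun_prop
  have h4 : Continuous fun s : ℝ => max s 0 ^ κ :=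
    (Real.continuous_rpow_const h.κ_pos.le).comp (continuous_id.max continuous_const)
  exact ((continuous_const.mul h4).mul h3).neg

theorem abs_delayedFlux_le (h : PicardData g f p κ γ lam M) (v : ℝ → ℝ) (ε : ℝ) {s b : ℝ}
    (hs : s ≤ b) (hb : 0 ≤ b) : |delayedFlux f κ γ lam ε v s| ≤ lam * M * b ^ κ := by
  have h1 : ‖∫ τ in (0 : ℝ)..1, τ ^ γ * f (v (max s 0 * τ - ε))‖ ≤ M * |1 - 0| :=
    intervalIntegral.norm_integral_le_of_norm_le_const fun τ hτ => h.abs_integrand_le hτ _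
  rw [sub_zero, abs_one, mul_one, Real.norm_eq_abs] at h1
  have h2 : max s 0 ^ κ ≤ b ^ κ :=
    Real.rpow_le_rpow (le_max_right _ _) (max_le hs hb) h.κ_pos.le
  have h3 : 0 ≤ max s 0 ^ κ := Real.rpow_nonneg (le_max_right _ _) _
  have h4 := h.lam_nonneg
  unfold delayedFlux
  rw [abs_neg, abs_mul, abs_mul, abs_of_nonneg h3, abs_of_nonneg h4]
  calc _ ≤ lam * b ^ κ * M := by gcongr
    _ = _ := by ring

theorem delayedFlux_of_nonpos (h : PicardData g f p κ γ lam M) (v : ℝ → ℝ) (ε : ℝ) {s : ℝ}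
    (hs : s ≤ 0) : delayedFlux f κ γ lam ε v s = 0 := by
  unfold delayedFlux
  rw [max_eq_right hs, Real.zero_rpow h.κ_pos.ne', mul_zero, zero_mul, neg_zero]

theorem hasDerivAt_delayedPicard (h : PicardData g f p κ γ lam M) {v : ℝ → ℝ} (hv : Continuous v)
    (ε d r : ℝ) : HasDerivAt (delayedPicard g f κ γ lam ε d v)
      (g (delayedFlux f κ γ lam ε v r)) r :=
  (hasDerivAt_primitive (h.inv.cont.comp (h.continuous_delayedFlux hv ε)) r).const_add d

theorem continuous_delayedPicard (h : PicardData g f p κ γ lam M) {v : ℝ → ℝ} (hv : Continuous v)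
    (ε d : ℝ) : Continuous (delayedPicard g f κ γ lam ε d v) :=
  continuous_iff_continuousAt.2 fun r => (h.hasDerivAt_delayedPicard hv ε d r).continuousAt

theorem delayedPicard_zero (ε d : ℝ) (v : ℝ → ℝ) : delayedPicard g f κ γ lam ε d v 0 = d := by
  simp [delayedPicard]

theorem abs_delayedPicard_sub_le (h : PicardData g f p κ γ lam M) {v : ℝ → ℝ} (hv : Continuous v)
    (ε d : ℝ) {r s b : ℝ} (hr : r ≤ b) (hs : s ≤ b) (hb : 0 ≤ b) :
    |delayedPicard g f κ γ lam ε d v r - delayedPicard g f κ γ lam ε d v s| ≤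
      g (lam * M * b ^ κ) * |r - s| := by
  wlog hsr : s ≤ r generalizing r s
  · rw [abs_sub_comm, abs_sub_comm r]
    exact this hs hr (le_of_not_ge hsr)
  rw [abs_of_nonneg (sub_nonneg.2 hsr)]
  exact abs_sub_le_of_hasDerivAt hsr (h.continuous_delayedPicard hv ε d).continuousOn
    (fun q _ => h.hasDerivAt_delayedPicard hv ε d q)
    (fun q hq => h.inv.abs_map_le (h.abs_delayedFlux_le v ε (hq.2.le.trans hr) hb))

/-- The delayed operator determines its value up to `b + ε` from its argument up to `b`. -/
theorem delayedPicard_congr {v w : ℝ → ℝ} {b ε : ℝ} (hb : 0 ≤ b) (hε : 0 ≤ ε)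
    (hvw : ∀ t ≤ b, v t = w t) (d : ℝ) {r : ℝ} (hr : r ≤ b + ε) :
    delayedPicard g f κ γ lam ε d v r = delayedPicard g f κ γ lam ε d w r := by
  unfold delayedPicard
  congr 1
  apply intervalIntegral.integral_congr
  intro s hs
  have hs' : max s 0 ≤ b + ε := by
    rcases le_total 0 r with h0 | h0
    · rw [uIcc_of_le h0] at hs
      exact max_le (hs.2.trans hr) (by positivity)
    · rw [uIcc_of_ge h0] at hs
      exact max_le (hs.2.trans (by positivity)) (by positivity)
  simp only [delayedFlux]
  congr 3
  apply intervalIntegral.integral_congr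
  intro τ hτ
  rw [uIcc_of_le zero_le_one] at hτ
  simp only
  rw [hvw]
  have : max s 0 * τ ≤ max s 0 := mul_le_of_le_one_right (le_max_right _ _) hτ.2
  linarith

/-- With a positive delay the equation is solved by the method of steps: each application of the
operator extends by ε the interval on which successive iterates agree. -/
theorem exists_approx_fixed (h : PicardData g f p κ γ lam M) (d : ℝ) {ε : ℝ} (hε : 0 ≤ ε)
    (k : ℕ) : ∃ v : ℝ → ℝ, Continuous v ∧
      ∀ r ≤ k * ε, v r = delayedPicard g f κ γ lam ε d v r := by
  set u : ℕ → ℝ → ℝ := fun k => (delayedPicard g f κ γ lam ε d)^[k] (fun _ => d) with hu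
  have hsucc : ∀ k, u (k + 1) = delayedPicard g f κ γ lam ε d (u k) := fun k =>
    Function.iterate_succ_apply' _ _ _
  have hcont : ∀ k, Continuous (u k) := by
    intro k
    induction k with
    | zero => exact continuous_const
    | succ k ih =>
      rw [hsucc]
      exact h.continuous_delayedPicard ih ε d
  have hstep : ∀ k : ℕ, ∀ r ≤ k * ε, u k r = u (k + 1) r := by
    intro k
    induction k with
    | zero =>
      intro r hr
      rw [Nat.cast_zero, zero_mul] at hr
      rw [hsucc]
      -- For r ≤ 0 the flux vanishes by convention, so the operator returns the constant d, which is
      -- the history the delay reads.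
      have h0 : ∫ s in (0 : ℝ)..r, g (delayedFlux f κ γ lam ε (u 0) s) = ∫ s in (0 : ℝ)..r, 0 := by
        apply intervalIntegral.integral_congr
        intro s hs
        rw [uIcc_of_ge hr] at hs
        simp only [h.delayedFlux_of_nonpos _ _ hs.2, h.inv.map_zero]
      simp only [delayedPicard, h0, intervalIntegral.integral_zero, add_zero]
      rfl
    | succ k ih =>
      intro r hr
      rw [hsucc (k + 1)]
      conv_lhs => rw [hsucc k]
      push_cast at hr
      exact delayedPicard_congr (by positivity) hε ih d (by linarith)
  refine ⟨u k, hcont k, fun r hr => ?_⟩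
  rw [← hsucc]
  exact hstep k r hr

/-- Passage to the limit in the integral operator. -/
theorem tendsto_delayedPicard (h : PicardData g f p κ γ lam M) {v : ℕ → ℝ → ℝ} {w : ℝ → ℝ}
    (hv : ∀ n, Continuous (v n)) {ε d : ℕ → ℝ} {d₀ : ℝ} (hd : Tendsto d atTop (𝓝 d₀))
    (hlim : ∀ t, Tendsto (fun n => v n (t - ε n)) atTop (𝓝 (w t))) (r : ℝ) :
    Tendsto (fun n => delayedPicard g f κ γ lam (ε n) (d n) (v n) r) atTop
      (𝓝 (delayedPicard g f κ γ lam 0 d₀ w r)) := by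
  have hflux : ∀ s, Tendsto (fun n => delayedFlux f κ γ lam (ε n) (v n) s) atTop
      (𝓝 (delayedFlux f κ γ lam 0 w s)) := by
    intro s
    apply Tendsto.neg
    apply Tendsto.const_mul
    apply intervalIntegral.tendsto_integral_filter_of_dominated_convergence (fun _ => M)
    · exact Eventually.of_forall fun n => (h.continuous_integrand (hv n) _ s).aestronglyMeasurable
    · exact Eventually.of_forall fun n => Eventually.of_forall fun τ hτ => h.abs_integrand_le hτ _
    · exact intervalIntegrable_const
    · refine Eventually.of_forall fun τ _ => ?_
      rw [sub_zero]
      exact ((h.cont.tendsto _).comp (hlim _)).const_mul _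
  apply hd.add
  set b := max r 0 with hb
  apply intervalIntegral.tendsto_integral_filter_of_dominated_convergence
    (fun _ => g (lam * M * b ^ κ))
  · exact Eventually.of_forall fun n =>
      (h.inv.cont.comp (h.continuous_delayedFlux (hv n) _)).aestronglyMeasurable
  · refine Eventually.of_forall fun n => Eventually.of_forall fun s hs =>
      h.inv.abs_map_le (h.abs_delayedFlux_le _ _ ?_ (le_max_right _ _))
    rcases le_total 0 r with h0 | h0
    · rw [uIoc_of_le h0] at hs
      exact hs.2.trans (le_max_left _ _)
    · rw [uIoc_of_ge h0] at hs
      exact hs.2.trans (le_max_right _ _)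
  · exact intervalIntegrable_const
  · exact Eventually.of_forall fun s _ => (h.inv.cont.tendsto _).comp (hflux s)

end PicardData

/-- A pointwise bounded sequence of functions which is locally uniformly Lipschitz has a pointwise
convergent subsequence with a continuous limit. -/
theorem exists_subseq_tendsto_of_lipschitz {w : ℕ → ℝ → ℝ} {B L : ℝ → ℝ}
    (hB : ∀ n r, |w n r| ≤ B r)
    (hL : ∀ n b r s, |r| ≤ b → |s| ≤ b → |w n r - w n s| ≤ L b * |r - s|) :
    ∃ (ψ : ℕ → ℕ) (w₀ : ℝ → ℝ), StrictMono ψ ∧ Continuous w₀ ∧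
      ∀ r, Tendsto (fun n => w (ψ n) r) atTop (𝓝 (w₀ r)) := by
  -- A convergent subsequence at all rational times comes from Tychonoff; the uniform Lipschitz
  -- bound carries it to real times.
  have hcomp : IsCompact (Set.univ.pi fun q : ℚ => Icc (-B q) (B q)) :=
    isCompact_univ_pi fun q => isCompact_Icc
  obtain ⟨l, -, ψ, hψ, hl⟩ := hcomp.tendsto_subseq (x := fun n (q : ℚ) => w n q)
    (fun n q _ => abs_le.1 (hB n q))
  have hlq : ∀ q : ℚ, Tendsto (fun n => w (ψ n) q) atTop (𝓝 (l q)) := fun q =>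
    (tendsto_pi_nhds.1 hl) q
  have hcauchy : ∀ r, ∃ x, Tendsto (fun n => w (ψ n) r) atTop (𝓝 x) := by
    intro r
    apply cauchySeq_tendsto_of_complete
    rw [Metric.cauchySeq_iff']
    intro η hη
    set L' := max (L (|r| + 1)) 0 + 1 with hL'
    have hL0 : 0 < L' := by positivity
    have hη' : 0 < min 1 (η / (3 * L')) := lt_min one_pos (by positivity)
    obtain ⟨q, hq⟩ := exists_rat_near r hη'
    have hq1 : |r - q| < 1 := hq.trans_le (min_le_left _ _)
    have hq2 : |r - q| < η / (3 * L') := hq.trans_le (min_le_right _ _)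
    have hclose : ∀ n, |w n r - w n q| < η / 3 := by
      intro n
      have h1 := hL n (|r| + 1) r q (by linarith) (by
        have := abs_sub_abs_le_abs_sub (q : ℝ) r
        rw [abs_sub_comm] at this
        linarith)
      calc |w n r - w n q| ≤ L (|r| + 1) * |r - q| := h1
        _ ≤ L' * |r - q| := by
          gcongr
          linarith [le_max_left (L (|r| + 1)) 0]
        _ < L' * (η / (3 * L')) := by gcongr
        _ = η / 3 := by field_simp
    obtain ⟨N, hN⟩ := Metric.cauchySeq_iff'.1 (hlq q).cauchySeq (η / 3) (by positivity)
    refine ⟨N, fun n hn => ?_⟩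
    have h1 := hclose (ψ n)
    have h2 := hclose (ψ N)
    have h3 := hN n hn
    rw [Real.dist_eq] at h3 ⊢
    rw [abs_lt] at h1 h2 h3 ⊢
    constructor <;> linarith
  choose w₀ hw₀ using hcauchy
  refine ⟨ψ, w₀, hψ, ?_, hw₀⟩
  have hLip : ∀ b r s, |r| ≤ b → |s| ≤ b → |w₀ r - w₀ s| ≤ L b * |r - s| := fun b r s hr hs =>
    le_of_tendsto ((hw₀ r).sub (hw₀ s)).abs (Eventually.of_forall fun n => hL _ b r s hr hs)
  rw [continuous_iff_continuousAt]
  intro r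
  rw [ContinuousAt, tendsto_iff_dist_tendsto_zero]
  have hz : Tendsto (fun s => L (|r| + 1) * |s - r|) (𝓝 r) (𝓝 0) := by
    have : Tendsto (fun s => L (|r| + 1) * |s - r|) (𝓝 r) (𝓝 (L (|r| + 1) * |r - r|)) := by
      apply Continuous.tendsto
      fun_prop
    simpa using this
  refine squeeze_zero' (Eventually.of_forall fun _ => dist_nonneg) ?_ hz
  filter_upwards [eventually_abs_sub_lt r one_pos] with s hs
  rw [Real.dist_eq]
  refine hLip _ _ _ ?_ (by linarith)
  have := abs_sub_abs_le_abs_sub s r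
  linarith

namespace PicardData

variable {g f : ℝ → ℝ} {p κ γ lam M : ℝ}

/-- Limits of approximate fixed points are fixed points. -/
theorem exists_subseq_tendsto_fixed (h : PicardData g f p κ γ lam M) {v : ℕ → ℝ → ℝ}
    (hv : ∀ n, Continuous (v n)) {ε d b : ℕ → ℝ} {d₀ : ℝ} (hd : Tendsto d atTop (𝓝 d₀))
    (hε0 : ∀ n, 0 ≤ ε n) (hε : Tendsto ε atTop (𝓝 0)) (hb : Tendsto b atTop atTop)
    (hfix : ∀ n, ∀ r ≤ b n, v n r = delayedPicard g f κ γ lam (ε n) (d n) (v n) r) :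
    ∃ (ψ : ℕ → ℕ) (w : ℝ → ℝ), StrictMono ψ ∧ Continuous w ∧
      (∀ r, Tendsto (fun n => v (ψ n) r) atTop (𝓝 (w r))) ∧
      w = delayedPicard g f κ γ lam 0 d₀ w := by
  set u : ℕ → ℝ → ℝ := fun n => delayedPicard g f κ γ lam (ε n) (d n) (v n) with hu
  have hLip : ∀ n b r s, |r| ≤ b → |s| ≤ b → |u n r - u n s| ≤ g (lam * M * b ^ κ) * |r - s| :=
    fun n b r s hr hs => h.abs_delayedPicard_sub_le (hv n) _ _ ((le_abs_self r).trans hr)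
      ((le_abs_self s).trans hs) ((abs_nonneg r).trans hr)
  obtain ⟨D, hD⟩ := hd.abs.bddAbove_range
  have hbound : ∀ n r, |u n r| ≤ D + g (lam * M * |r| ^ κ) * |r| := by
    intro n r
    have h1 := hLip n |r| r 0 le_rfl (by simp)
    have h2 : u n 0 = d n := delayedPicard_zero _ _ _
    have h3 : |d n| ≤ D := hD ⟨n, rfl⟩
    rw [h2, sub_zero] at h1
    have h4 := abs_sub_abs_le_abs_sub (u n r) (d n)
    linarith
  obtain ⟨ψ, w, hψ, hw, hlim⟩ := exists_subseq_tendsto_of_lipschitz hbound hLip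
  have hev : ∀ r : ℝ, ∀ᶠ n in atTop, ∀ s ≤ r, v (ψ n) s = u (ψ n) s := by
    intro r
    filter_upwards [(hb.comp hψ.tendsto_atTop).eventually_ge_atTop r] with n hn s hs
    exact hfix _ s (hs.trans hn)
  refine ⟨ψ, w, hψ, hw, fun r => ?_, ?_⟩
  · refine (hlim r).congr' ?_
    filter_upwards [hev r] with n hn using (hn r le_rfl).symm
  · funext r
    refine tendsto_nhds_unique (hlim r) (h.tendsto_delayedPicard (fun n => hv (ψ n))
      (hd.comp hψ.tendsto_atTop) (fun t => ?_) r)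
    have hεψ : Tendsto (fun n => ε (ψ n)) atTop (𝓝 0) := hε.comp hψ.tendsto_atTop
    -- Reading the function with a vanishing delay does not change the limit, because the
    -- approximations are uniformly Lipschitz.
    have hdiff : Tendsto (fun n => u (ψ n) (t - ε (ψ n)) - u (ψ n) t) atTop (𝓝 0) := by
      have hz : Tendsto (fun n => g (lam * M * (|t| + 1) ^ κ) * ε (ψ n)) atTop (𝓝 0) := by
        have := hεψ.const_mul (g (lam * M * (|t| + 1) ^ κ))
        rwa [mul_zero] at this
      refine squeeze_zero_norm' ?_ hz
      filter_upwards [hεψ.eventually (gt_mem_nhds one_pos)] with n hn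
      have h0 := hε0 (ψ n)
      have h1 := hLip (ψ n) (|t| + 1) (t - ε (ψ n)) t
        (by
          have := abs_sub t (ε (ψ n))
          rw [abs_of_nonneg h0] at this
          linarith) (by linarith)
      rwa [sub_sub_cancel_left, abs_neg, abs_of_nonneg h0] at h1
    have hsum := hdiff.add (hlim t)
    rw [zero_add] at hsum
    refine hsum.congr' ?_
    filter_upwards [hev t] with n hn
    rw [sub_add_cancel]
    exact (hn _ (by linarith [hε0 (ψ n)])).symm

theorem exists_fixed (h : PicardData g f p κ γ lam M) (d : ℝ) :
    ∃ w : ℝ → ℝ, Continuous w ∧ w = delayedPicard g f κ γ lam 0 d w := by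
  have hex : ∀ n : ℕ, ∃ v : ℝ → ℝ, Continuous v ∧
      ∀ r ≤ (n : ℝ) + 1, v r = delayedPicard g f κ γ lam (1 / ((n : ℝ) + 1)) d v r := by
    intro n
    -- With delay 1/(n + 1), (n + 1)² steps reach time n + 1, so the intervals exhaust the half-line
    -- while the delay tends to 0.
    obtain ⟨v, hv, hvr⟩ := h.exists_approx_fixed d (ε := 1 / ((n : ℝ) + 1)) (by positivity)
      ((n + 1) ^ 2)
    refine ⟨v, hv, fun r hr => hvr r (hr.trans (le_of_eq ?_))⟩
    push_cast
    field_simp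
  choose v hv hvr using hex
  obtain ⟨ψ, w, -, hw, -, hfix⟩ := h.exists_subseq_tendsto_fixed hv (d := fun _ => d)
    tendsto_const_nhds (fun n => by positivity) tendsto_one_div_add_atTop_nhds_zero_nat
    (tendsto_atTop_add_const_right _ _ tendsto_natCast_atTop_atTop) hvr
  exact ⟨w, hw, hfix⟩

end PicardData

/-- The flux of `u`. -/
noncomputable def flux (f : ℝ → ℝ) (γ lam : ℝ) (u : ℝ → ℝ) (r : ℝ) : ℝ :=
  -(lam * ∫ t in (0 : ℝ)..r, t ^ γ * f (u t))

/-- Substituting t = r τ absorbs the singular factor r^(-α) into the positive power r^(γ+1-α). -/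
theorem delayedFlux_eq (f : ℝ → ℝ) (α γ lam : ℝ) (u : ℝ → ℝ) {r : ℝ} (hr : 0 < r) :
    delayedFlux f (γ + 1 - α) γ lam 0 u r = r ^ (-α) * flux f γ lam u r := by
  have h1 := intervalIntegral.mul_integral_comp_mul_left (a := 0) (b := 1)
    (f := fun t : ℝ => t ^ γ * f (u t)) r
  rw [mul_zero, mul_one] at h1
  have h2 : ∫ τ in (0 : ℝ)..1, (r * τ) ^ γ * f (u (r * τ)) =
      r ^ γ * ∫ τ in (0 : ℝ)..1, τ ^ γ * f (u (r * τ)) := by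
    rw [← intervalIntegral.integral_const_mul]
    apply intervalIntegral.integral_congr
    intro τ hτ
    rw [uIcc_of_le zero_le_one] at hτ
    simp only
    rw [Real.mul_rpow hr.le hτ.1, mul_assoc]
  simp only [delayedFlux, flux, max_eq_left hr.le, sub_zero]
  rw [← h1, h2, sub_eq_add_neg, Real.rpow_add hr, Real.rpow_add_one hr.ne']
  ring

namespace PicardData

variable {g f : ℝ → ℝ} {p γ lam M α : ℝ}

theorem hasDerivAt_flux (h : PicardData g f p (γ + 1 - α) γ lam M) {u : ℝ → ℝ} (hu : Continuous u)
    (r : ℝ) : HasDerivAt (flux f γ lam u) (-(lam * r ^ γ * f (u r))) r := by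
  have h1 : Continuous fun t : ℝ => t ^ γ * f (u t) :=
    (Real.continuous_rpow_const h.nonneg).mul (h.cont.comp hu)
  have := ((hasDerivAt_primitive h1 r).const_mul lam).neg
  rw [← mul_assoc] at this
  exact this

theorem isTrajectory (h : PicardData g f p (γ + 1 - α) γ lam M) {u : ℝ → ℝ} {d : ℝ}
    (hu : Continuous u) (hfix : u = delayedPicard g f (γ + 1 - α) γ lam 0 d u) :
    IsTrajectory g f α γ lam d u (flux f γ lam u) where
  cont_u := hu.continuousOn
  cont_y := fun r _ => (h.hasDerivAt_flux hu r).continuousAt.continuousWithinAt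
  u_zero := by
    rw [hfix]
    exact delayedPicard_zero _ _ _
  y_zero := by simp [flux]
  deriv_u r hr := by
    rw [← delayedFlux_eq f α γ lam u hr]
    conv => enter [1]; rw [hfix]
    exact h.hasDerivAt_delayedPicard hu 0 d r
  deriv_y r _ := h.hasDerivAt_flux hu r

end PicardData

/-! ### Rotation in the phase plane and duration of a quarter turn -/

/-- The primitive of `|f|^(-1/p)` vanishing at `0`. -/
noncomputable def crossingPotential (f : ℝ → ℝ) (p t : ℝ) : ℝ :=
  ∫ s in (0 : ℝ)..t, |f s| ^ (-1 / p)

/-- A bounded nondecreasing reaction term with `|f|^(-1/p)` locally integrable. -/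
structure IsMonotoneReaction (f : ℝ → ℝ) (p M : ℝ) : Prop extends IsReaction f where
  mono : Monotone f
  bound : ∀ t, |f t| ≤ M
  integrable : ∀ a b, IntervalIntegrable (fun s => |f s| ^ (-1 / p)) volume a b

namespace IsMonotoneReaction

variable {f : ℝ → ℝ} {p M : ℝ}

theorem bound_pos (hf : IsMonotoneReaction f p M) : 0 < M :=
  (hf.pos one_pos).trans_le ((le_abs_self _).trans (hf.bound 1))

theorem neg (hf : IsMonotoneReaction f p M) : IsMonotoneReaction (fun t => -f (-t)) p M where
  toIsReaction := hf.toIsReaction.neg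
  mono s t hst := neg_le_neg (hf.mono (neg_le_neg hst))
  bound t := by
    rw [abs_neg]
    exact hf.bound _
  integrable a b := by
    have := (hf.integrable (-a) (-b)).comp_mul_left (c := -1)
    simpa [neg_div_neg_eq] using this

theorem crossingPotential_neg (f : ℝ → ℝ) (p t : ℝ) :
    crossingPotential (fun t => -f (-t)) p t = -crossingPotential f p (-t) := by
  unfold crossingPotential
  simp only [abs_neg]
  rw [intervalIntegral.integral_comp_neg (fun s => |f s| ^ (-1 / p)), neg_zero,
    intervalIntegral.integral_symm]

theorem continuous_crossingPotential (hf : IsMonotoneReaction f p M) :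
    Continuous (crossingPotential f p) :=
  intervalIntegral.continuous_primitive hf.integrable 0

theorem ne_zero (hf : IsMonotoneReaction f p M) {t : ℝ} (ht : t ≠ 0) : f t ≠ 0 := by
  intro h
  have := hf.mul_pos t ht
  simp [h] at this

theorem hasDerivAt_crossingPotential (hf : IsMonotoneReaction f p M) {t : ℝ} (ht : t ≠ 0) :
    HasDerivAt (crossingPotential f p) (|f t| ^ (-1 / p)) t := by
  apply intervalIntegral.integral_hasDerivAt_right (hf.integrable 0 t)
  · have : Measurable fun s => |f s| ^ (-1 / p) :=
      (hf.cont.abs.measurable).pow_const _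
    exact this.stronglyMeasurable.stronglyMeasurableAtFilter
  · exact (hf.cont.abs.continuousAt).rpow_const (Or.inl (abs_ne_zero.2 (hf.ne_zero ht)))

theorem primitive_neg (f : ℝ → ℝ) (t : ℝ) :
    primitive (fun t => -f (-t)) t = primitive f (-t) := by
  unfold primitive
  rw [intervalIntegral.integral_neg, intervalIntegral.integral_comp_neg (fun s => f s), neg_zero,
    intervalIntegral.integral_symm, neg_neg]

/-- Beyond 1 the slope of F is at least f(1) > 0, so F is coercive. -/
theorem le_of_primitive_le (hf : IsMonotoneReaction f p M) {E t : ℝ} (hE : 0 ≤ E)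
    (ht : primitive f t ≤ E) : t ≤ 1 + E / f 1 := by
  have h1 : 0 < f 1 := hf.pos one_pos
  rcases le_total t 1 with h | h
  · have : 0 ≤ E / f 1 := by positivity
    linarith
  · have h2 := sub_le_sub_of_hasDerivAt_le (P := fun s => f 1 * s) (P' := fun _ => f 1) h
      (continuous_const.mul continuous_id).continuousOn (continuous_primitive hf.cont).continuousOn
      (fun q _ => by simpa using (hasDerivAt_id q).const_mul (f 1))
      (fun q _ => hasDerivAt_primitive hf.cont q) (fun q hq => hf.mono hq.1.le)
    have h3 := primitive_pos_of_ne hf.cont hf.mul_pos one_ne_zero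
    have h4 : (t - 1) ≤ E / f 1 := by
      rw [le_div_iff₀ h1]
      linarith
    linarith

theorem exists_bound_of_primitive_le (hf : IsMonotoneReaction f p M) (E : ℝ) (hE : 0 ≤ E) :
    ∃ B, ∀ t, primitive f t ≤ E → |t| ≤ B := by
  refine ⟨max (1 + E / f 1) (1 + E / -f (-1)), fun t ht => ?_⟩
  rw [abs_le']
  refine ⟨(hf.le_of_primitive_le hE ht).trans (le_max_left _ _), ?_⟩
  refine (hf.neg.le_of_primitive_le hE ?_).trans (le_max_right _ _)
  rwa [primitive_neg, neg_neg]

end IsMonotoneReaction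

/-- The functions `u`, `-y`, `-u`, `y`, `u`, … whose signs describe the rotation of a trajectory in
the phase plane. -/
def phase (u y : ℝ → ℝ) : ℕ → ℝ → ℝ
  | 0 => u
  | 1 => fun r => -y r
  | (j + 2) => fun r => -phase u y j r

theorem phase_add_two (u y : ℝ → ℝ) (j : ℕ) (r : ℝ) : phase u y (j + 2) r = -phase u y j r := rfl

theorem phase_neg (u y : ℝ → ℝ) (j : ℕ) (r : ℝ) :
    phase (fun r => -u r) (fun r => -y r) j r = phase u y (j + 2) r := by
  induction j using Nat.twoStepInduction with
  | zero => rfl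
  | one => rfl
  | more j ih _ => rw [phase_add_two, ih, phase_add_two _ _ (j + 2)]

/-- Lower bound for the variation of the potential per unit of time during a phase of length at
least `ε`. -/
noncomputable def crossingSpeed (g : ℝ → ℝ) (α γ p lam M ε : ℝ) : ℝ :=
  g (lam / (γ + 1) * (ε / 3) ^ (γ + 1 - α) * M) /
    (lam / (γ + 1) * (ε / 3) ^ (γ + 1 - α) * M) ^ (1 / p) *
    (lam / (γ + 1) * (ε / 3) ^ (γ + 1 - α)) ^ (1 / p)

theorem mul_rpow_le_powerWeight {γ a b : ℝ} (hγ : 0 ≤ γ) (ha : 0 ≤ a) (hab : a < b) :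
    b ^ γ * (b - a) / (γ + 1) ≤ powerWeight γ a b := by
  unfold powerWeight
  rw [← sub_div]
  gcongr
  rw [Real.rpow_add_one (ha.trans_lt hab).ne']
  have h1 : a ^ (γ + 1) ≤ b ^ γ * a := by
    rcases ha.eq_or_lt with h | h
    · rw [← h, Real.zero_rpow (by positivity), mul_zero]
    · rw [Real.rpow_add_one h.ne']
      gcongr
  linarith

/-- The sign of α decides which bound is used: for α ≥ 0 the factor r^(-α) is compared with b^(-α),
for α ≤ 0 with l^(-α). -/
theorem third_rpow_le {α γ r b l : ℝ} (hγ : 0 ≤ γ) (hαγ : α ≤ γ) (hl : 0 < l) (hlr : l ≤ r)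
    (hrb : r ≤ b) : l ^ (γ - α) ≤ r ^ (-α) * b ^ γ := by
  have hr : 0 < r := hl.trans_le hlr
  have hb : 0 < b := hr.trans_le hrb
  rcases le_total 0 α with h | h
  · calc l ^ (γ - α) ≤ b ^ (γ - α) := Real.rpow_le_rpow hl.le (hlr.trans hrb) (by linarith)
      _ = b ^ (-α) * b ^ γ := by
        rw [← Real.rpow_add hb]
        ring_nf
      _ ≤ r ^ (-α) * b ^ γ := by
        have := Real.rpow_le_rpow_of_nonpos hr hrb (by linarith : -α ≤ 0)
        gcongr
  · calc l ^ (γ - α) = l ^ (-α) * l ^ γ := by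
          rw [← Real.rpow_add hl]
          ring_nf
      _ ≤ r ^ (-α) * b ^ γ := by
        have h1 := Real.rpow_le_rpow hl.le hlr (by linarith : 0 ≤ -α)
        have h2 := Real.rpow_le_rpow hl.le (hlr.trans hrb) hγ
        gcongr

namespace IsTrajectory

variable {g f : ℝ → ℝ} {α γ p lam d M : ℝ} {u y : ℝ → ℝ}

theorem flux_strictAntiOn (hf : IsReaction f) (he : Exponents α γ p lam)
    (h : IsTrajectory g f α γ lam d u y) {a b : ℝ} (ha : 0 ≤ a)
    (hu : ∀ r ∈ Ioo a b, 0 < u r) : StrictAntiOn y (Icc a b) := by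
  apply strictAntiOn_of_deriv_neg (convex_Icc a b) (h.continuousOn_y ha)
  rw [interior_Icc]
  intro r hr
  have hr0 : 0 < r := ha.trans_lt hr.1
  rw [(h.deriv_y r hr0).deriv]
  have := hf.pos (hu r hr)
  have := Real.rpow_pos_of_pos hr0 γ
  have := he.lam_pos
  have : 0 < lam * r ^ γ * f (u r) := by positivity
  linarith

theorem strictAntiOn (hg : IsFluxInverse g p)
    (h : IsTrajectory g f α γ lam d u y) {a b : ℝ} (ha : 0 ≤ a)
    (hy : ∀ r ∈ Ioo a b, y r < 0) : StrictAntiOn u (Icc a b) := by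
  apply strictAntiOn_of_deriv_neg (convex_Icc a b) (h.continuousOn_u ha)
  rw [interior_Icc]
  intro r hr
  have hr0 : 0 < r := ha.trans_lt hr.1
  rw [(h.deriv_u r hr0).deriv]
  have := Real.rpow_pos_of_pos hr0 (-α)
  exact hg.neg (mul_neg_of_pos_of_neg this (hy r hr))

/-- If the flux dominates `|f(u)|` then the potential decreases at least at the crossing speed. -/
theorem crossing_le (hg : IsFluxInverse g p) (hf : IsMonotoneReaction f p M)
    (he : Exponents α γ p lam) (h : IsTrajectory g f α γ lam d u y) {a b ε : ℝ} (ha : 0 ≤ a)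
    (hab : a ≤ b) (hε : 0 < ε) (hu : ∀ r ∈ Ioo a b, u r ≠ 0)
    (hy : ∀ r ∈ Ioo a b,
      lam / (γ + 1) * (ε / 3) ^ (γ + 1 - α) * |f (u r)| ≤ -(r ^ (-α) * y r)) :
    crossingSpeed g α γ p lam M ε * (b - a) ≤
      crossingPotential f p (u a) - crossingPotential f p (u b) := by
  have hγ := he.nonneg
  have hlam := he.lam_pos
  have hM := hf.bound_pos
  have hp := hg.p_pos
  set k := lam / (γ + 1) * (ε / 3) ^ (γ + 1 - α) with hk
  have hk0 : 0 < k := by positivity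
  have key := sub_le_sub_of_hasDerivAt_le (P := fun r => crossingSpeed g α γ p lam M ε * r)
    (P' := fun _ => crossingSpeed g α γ p lam M ε)
    (Q := fun r => -crossingPotential f p (u r))
    (Q' := fun r => -(|f (u r)| ^ (-1 / p) * g (r ^ (-α) * y r))) hab
    (continuous_const.mul continuous_id).continuousOn
    (hf.continuous_crossingPotential.comp_continuousOn (h.continuousOn_u ha)).neg
    (fun q _ => by simpa using (hasDerivAt_id q).const_mul (crossingSpeed g α γ p lam M ε))
    (fun q hq => ((hf.hasDerivAt_crossingPotential (hu q hq)).comp q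
      (h.deriv_u q (ha.trans_lt hq.1))).neg)
    (fun q hq => by
      have hfq : 0 < |f (u q)| := abs_pos.2 (hf.ne_zero (hu q hq))
      have h1 : g (k * |f (u q)|) ≤ -g (q ^ (-α) * y q) := by
        rw [← hg.odd]
        exact hg.mono.monotone (hy q hq)
      -- As f is bounded by M, the power lower bound for g on [0, kM] gives g(k|f(u)|) ≥ const ·
      -- |f(u)|^(1/p), which cancels the factor |f(u)|^(-1/p) in the derivative of Ψ(u).
      have h2 := hg.mul_rpow_le (s := k * |f (u q)|) (S := k * M) (by positivity)
        (by
          have := hf.bound (u q)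
          gcongr) (by positivity)
      rw [Real.mul_rpow hk0.le hfq.le] at h2
      have h3 : |f (u q)| ^ (-1 / p) * |f (u q)| ^ (1 / p) = 1 := by
        rw [← Real.rpow_add hfq, neg_div, neg_add_cancel, Real.rpow_zero]
      have h4 : 0 < |f (u q)| ^ (-1 / p) := Real.rpow_pos_of_pos hfq _
      rw [← mul_neg]
      calc crossingSpeed g α γ p lam M ε
          = |f (u q)| ^ (-1 / p) *
            (g (k * M) / (k * M) ^ (1 / p) * (k ^ (1 / p) * |f (u q)| ^ (1 / p))) := by
            unfold crossingSpeed
            linear_combination (-(g (k * M) / (k * M) ^ (1 / p) * k ^ (1 / p))) * h3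
        _ ≤ _ := by
          gcongr
          exact h2.trans h1)
  linarith

theorem crossingSpeed_pos (hg : IsFluxInverse g p) (hf : IsMonotoneReaction f p M)
    (he : Exponents α γ p lam) {ε : ℝ} (hε : 0 < ε) : 0 < crossingSpeed g α γ p lam M ε := by
  have hγ := he.nonneg
  have hlam := he.lam_pos
  have hM := hf.bound_pos
  unfold crossingSpeed
  have hk0 : 0 < lam / (γ + 1) * (ε / 3) ^ (γ + 1 - α) := by positivity
  have := hg.pos (mul_pos hk0 hM)
  positivity

/-- The middle third has length (b - a)/3 and the variation over it is at most 2J, whence the factor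
6. -/
theorem third_bound {a b J c : ℝ} {v Ψ : ℝ → ℝ} (hab : a < b)
    (hJ : ∀ r ∈ Icc a b, |Ψ (v r)| ≤ J)
    (h : c * ((b - (b - a) / 3) - (a + (b - a) / 3)) ≤
      Ψ (v (a + (b - a) / 3)) - Ψ (v (b - (b - a) / 3))) : c * (b - a) ≤ 6 * J := by
  have h1 := hJ (a + (b - a) / 3) ⟨by linarith, by linarith⟩
  have h2 := hJ (b - (b - a) / 3) ⟨by linarith, by linarith⟩
  rw [abs_le] at h1 h2
  linarith

/-- During a phase the next function of the cycle is positive, and the length of the phase is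
controlled by the variation of the potential. -/
theorem phase_duration (hg : IsFluxInverse g p) (hf : IsMonotoneReaction f p M)
    (he : Exponents α γ p lam) (h : IsTrajectory g f α γ lam d u y) {a b : ℝ} (ha : 0 ≤ a)
    (hab : a < b) (j : ℕ) (hj : ∀ r ∈ Ioo a b, 0 < phase u y j r) (hj' : phase u y (j + 1) a = 0) :
    (∀ r ∈ Ioc a b, 0 < phase u y (j + 1) r) ∧
    ∀ ε J, 0 < ε → ε ≤ b - a → (∀ r ∈ Icc a b, |crossingPotential f p (u r)| ≤ J) →
      crossingSpeed g α γ p lam M ε * (b - a) ≤ 6 * J := by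
  have hγ := he.nonneg
  have hlam := he.lam_pos
  induction j using Nat.twoStepInduction generalizing f d u y with
  | zero =>
    have hya : y a = 0 := neg_eq_zero.1 hj'
    have hanti := h.flux_strictAntiOn hf.toIsReaction he ha hj
    have hneg : ∀ r ∈ Ioc a b, y r < 0 := fun r hr => by
      rw [← hya]
      exact hanti ⟨le_rfl, hab.le⟩ ⟨hr.1.le, hr.2⟩ hr.1
    refine ⟨fun r hr => neg_pos.2 (hneg r hr), fun ε J hε hεb hJ => ?_⟩
    have huanti := h.strictAntiOn hg ha (b := b) fun r hr => hneg r ⟨hr.1, hr.2.le⟩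
    refine third_bound (Ψ := crossingPotential f p) (v := u) hab hJ (h.crossing_le hg hf he
      (by linarith) (by linarith) hε (fun r hr => ?_) fun r hr => ?_)
    · exact (hj r ⟨by linarith [hr.1], by linarith [hr.2]⟩).ne'
    · have har : a < r := by linarith [hr.1]
      have hrb : r < b := by linarith [hr.2]
      have hr0 : 0 < r := ha.trans_lt har
      have hfr : 0 < f (u r) := hf.pos (hj r ⟨har, hrb⟩)
      -- While u > 0 decreases, f(u) was at least f(u(r)) at all earlier times of the phase. So the
      -- flux built up since a, where it was 0, dominates f(u(r)); the first third provides the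
      -- time.
      have h1 := h.le_flux he ha har.le (K := f (u r)) fun q hq =>
        hf.mono (huanti.antitoneOn ⟨hq.1.le, hq.2.le.trans hrb.le⟩ ⟨har.le, hrb.le⟩ hq.2.le)
      rw [hya, zero_sub] at h1
      have h2 := mul_rpow_le_powerWeight hγ ha har
      have h3 := third_rpow_le hγ he.le (l := ε / 3) (r := r) (b := r) (by positivity)
        (by linarith [hr.1]) le_rfl
      have h4 : ε / 3 ≤ r - a := by linarith [hr.1]
      rw [abs_of_pos hfr, show γ + 1 - α = (γ - α) + 1 by ring,
        Real.rpow_add_one (by positivity), ← mul_neg]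
      have h5 : 0 < r ^ (-α) := Real.rpow_pos_of_pos hr0 _
      calc lam / (γ + 1) * ((ε / 3) ^ (γ - α) * (ε / 3)) * f (u r)
          ≤ lam / (γ + 1) * (r ^ (-α) * r ^ γ * (r - a)) * f (u r) := by gcongr
        _ = r ^ (-α) * (lam * f (u r) * (r ^ γ * (r - a) / (γ + 1))) := by ring
        _ ≤ r ^ (-α) * (-y r) := by
          gcongr
          exact le_trans (by gcongr) h1
  | one =>
    have hua : u a = 0 := neg_eq_zero.1 hj'
    have hy : ∀ r ∈ Ioo a b, y r < 0 := fun r hr => neg_pos.1 (hj r hr)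
    have huanti := h.strictAntiOn hg ha hy
    have hneg : ∀ r ∈ Ioc a b, u r < 0 := fun r hr => by
      rw [← hua]
      exact huanti ⟨le_rfl, hab.le⟩ ⟨hr.1.le, hr.2⟩ hr.1
    have hyb : y b ≤ 0 := by
      have hc : ContinuousOn y (Icc a b) := h.continuousOn_y ha
      have hcl : b ∈ closure (Ioo a b) := by
        rw [closure_Ioo hab.ne]
        exact ⟨hab.le, le_rfl⟩
      have : ContinuousWithinAt y (Ioo a b) b :=
        (hc b ⟨hab.le, le_rfl⟩).mono Ioo_subset_Icc_self
      have hmem := this.mem_closure_image hcl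
      exact closure_minimal (t := Iic 0) (by
        rintro _ ⟨q, hq, rfl⟩
        exact (hy q hq).le) isClosed_Iic hmem
    refine ⟨fun r hr => neg_pos.2 (hneg r hr), fun ε J hε hεb hJ => ?_⟩
    refine third_bound (Ψ := crossingPotential f p) (v := u) hab hJ (h.crossing_le hg hf he
      (by linarith) (by linarith) hε (fun r hr => ?_) fun r hr => ?_)
    · exact (hneg r ⟨by linarith [hr.1], by linarith [hr.2]⟩).ne
    · have har : a < r := by linarith [hr.1]
      have hrb : r < b := by linarith [hr.2]
      have hr0 : 0 < r := ha.trans_lt har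
      have hfr : f (u r) < 0 := hf.neg_of_neg (hneg r ⟨har, hrb.le⟩)
      -- Here |f(u)| grows along the phase and the flux is still nonpositive at b. So the flux at r
      -- must cover what is lost on [r, b], at least in proportion to |f(u(r))|; the last third
      -- provides the time.
      have h1 := h.flux_le he hr0.le hrb.le (K := f (u r)) fun q hq =>
        hf.mono (huanti.antitoneOn ⟨har.le, hrb.le⟩ ⟨har.le.trans hq.1.le, hq.2.le⟩ hq.1.le)
      have h2 := mul_rpow_le_powerWeight hγ hr0.le hrb
      have h3 := third_rpow_le hγ he.le (l := ε / 3) (r := r) (b := b) (by positivity)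
        (by linarith [hr.1]) hrb.le
      have h4 : ε / 3 ≤ b - r := by linarith [hr.2]
      rw [abs_of_neg hfr, show γ + 1 - α = (γ - α) + 1 by ring,
        Real.rpow_add_one (by positivity), ← mul_neg]
      have h5 : 0 < r ^ (-α) := Real.rpow_pos_of_pos hr0 _
      have h6 : 0 < -f (u r) := by linarith
      have h7 : 0 < b := hr0.trans hrb
      calc lam / (γ + 1) * ((ε / 3) ^ (γ - α) * (ε / 3)) * -f (u r)
          ≤ lam / (γ + 1) * (r ^ (-α) * b ^ γ * (b - r)) * -f (u r) := by gcongr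
        _ = r ^ (-α) * (lam * -f (u r) * (b ^ γ * (b - r) / (γ + 1))) := by ring
        _ ≤ r ^ (-α) * (-y r) := by
          gcongr
          calc lam * -f (u r) * (b ^ γ * (b - r) / (γ + 1))
              ≤ lam * -f (u r) * powerWeight γ r b := by gcongr
            _ ≤ -y r := by linarith
  | more j ih _ =>
    -- Reflecting the trajectory shifts the phase index by two.
    have h1 := ih hf.neg (h.neg hg) (fun r hr => by
        rw [phase_neg]
        exact hj r hr) (by
        rw [phase_neg]
        exact hj')
    refine ⟨fun r hr => ?_, fun ε J hε hεb hJ => h1.2 ε J hε hεb fun r hr => ?_⟩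
    · have := h1.1 r hr
      rwa [phase_neg] at this
    · rw [IsMonotoneReaction.crossingPotential_neg, neg_neg, abs_neg]
      exact hJ r hr

theorem continuousOn_phase (h : IsTrajectory g f α γ lam d u y) (j : ℕ) :
    ContinuousOn (phase u y j) (Ici 0) := by
  induction j using Nat.twoStepInduction with
  | zero => exact h.cont_u
  | one => exact h.cont_y.neg
  | more j ih _ => exact ih.neg

theorem exists_potential_bound (hg : IsFluxInverse g p) (hf : IsMonotoneReaction f p M)
    (he : Exponents α γ p lam) (h : IsTrajectory g f α γ lam d u y) :
    ∃ J, ∀ r, 0 ≤ r → |crossingPotential f p (u r)| ≤ J := by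
  have hE : 0 ≤ primitive f d := by
    by_cases hd : d = 0
    · rw [hd, primitive_zero]
    · exact (primitive_pos_of_ne hf.cont hf.mul_pos hd).le
  obtain ⟨B, hB⟩ := hf.exists_bound_of_primitive_le _ hE
  obtain ⟨J, hJ⟩ := isCompact_Icc.exists_bound_of_continuousOn
    (hf.continuous_crossingPotential.continuousOn (s := Icc (-B) B))
  exact ⟨J, fun r hr => hJ _ (abs_le.1 (hB _ (h.primitive_le hg hf.cont he hr)))⟩

theorem exists_next_event (hg : IsFluxInverse g p) (hf : IsMonotoneReaction f p M)
    (he : Exponents α γ p lam) (h : IsTrajectory g f α γ lam d u y) {a : ℝ} (ha : 0 ≤ a)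
    (j : ℕ) (hj : 0 < phase u y j a) (hj' : phase u y (j + 1) a = 0) :
    ∃ b, a < b ∧ (∀ r ∈ Ico a b, 0 < phase u y j r) ∧ phase u y j b = 0 ∧
      ∀ r ∈ Ioc a b, 0 < phase u y (j + 1) r := by
  obtain ⟨J, hJ⟩ := h.exists_potential_bound hg hf he
  have hC := crossingSpeed_pos hg hf he one_pos
  set C := crossingSpeed g α γ p lam M 1
  have hJ0 : 0 ≤ J := (abs_nonneg _).trans (hJ 0 le_rfl)
  -- A phase lasting T would give C T = 6 J + C ≤ 6 J. The summand 1 also ensures T ≥ 1, the minimal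
  -- length for which C was taken.
  set T := 6 * J / C + 1 with hT
  have hT1 : 1 ≤ T := by
    have : 0 ≤ 6 * J / C := by positivity
    linarith
  set Z := {r ∈ Icc a (a + T) | phase u y j r ≤ 0} with hZ
  have hcont : ContinuousOn (phase u y j) (Icc a (a + T)) :=
    (h.continuousOn_phase j).mono fun r hr => ha.trans hr.1
  have hZc : IsCompact Z :=
    isCompact_Icc.of_isClosed_subset (hcont.preimage_isClosed_of_isClosed isClosed_Icc isClosed_Iic)
      (fun r hr => hr.1)
  have hZn : Z.Nonempty := by
    by_contra hne
    have hpos : ∀ r ∈ Icc a (a + T), 0 < phase u y j r := fun r hr => by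
      by_contra hr'
      exact hne ⟨r, hr, not_lt.1 hr'⟩
    have h1 := (h.phase_duration hg hf he ha (by linarith : a < a + T) j
      (fun r hr => hpos r ⟨hr.1.le, hr.2.le⟩) hj').2 1 J one_pos (by linarith)
      (fun r hr => hJ r (ha.trans hr.1))
    rw [add_sub_cancel_left, hT, mul_add, mul_one, mul_div_cancel₀ _ hC.ne'] at h1
    change _ + C ≤ _ at h1
    linarith
  obtain ⟨b, hbZ, hbmin⟩ := hZc.exists_isLeast hZn
  have hab : a < b := by
    refine lt_of_le_of_ne hbZ.1.1 fun hab => ?_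
    have := hbZ.2
    rw [← hab] at this
    linarith
  have hpos : ∀ r ∈ Ico a b, 0 < phase u y j r := fun r hr => by
    by_contra hr'
    have := hbmin (a := r) ⟨⟨hr.1, hr.2.le.trans hbZ.1.2⟩, not_lt.1 hr'⟩
    linarith [hr.2]
  have hb0 : 0 ≤ phase u y j b := by
    have hcl : b ∈ closure (Ico a b) := by
      rw [closure_Ico hab.ne]
      exact ⟨hab.le, le_rfl⟩
    have hcw : ContinuousWithinAt (phase u y j) (Ico a b) b :=
      (hcont b hbZ.1).mono fun r hr => ⟨hr.1, hr.2.le.trans hbZ.1.2⟩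
    have hmem := hcw.mem_closure_image hcl
    exact closure_minimal (t := Ici 0) (by
      rintro _ ⟨q, hq, rfl⟩
      exact (hpos q hq).le) isClosed_Ici hmem
  exact ⟨b, hab, hpos, le_antisymm hbZ.2 hb0,
    (h.phase_duration hg hf he ha hab j (fun r hr => hpos r ⟨hr.1.le, hr.2⟩) hj').1⟩

end IsTrajectory

/-! ### The sequence of quadrant changes -/

/-- `e` lists the times at which the trajectory changes quadrant: the odd terms are zeros of `u`
and the even ones are zeros of the flux. -/
structure IsEventSeq (u y : ℝ → ℝ) (e : ℕ → ℝ) : Prop where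
  zero : e 0 = 0
  lt : ∀ j, e j < e (j + 1)
  pos : ∀ j, ∀ r ∈ Ico (e j) (e (j + 1)), 0 < phase u y j r
  eq_zero : ∀ j, phase u y j (e (j + 1)) = 0
  pos_succ : ∀ j, ∀ r ∈ Ioc (e j) (e (j + 1)), 0 < phase u y (j + 1) r

theorem IsEventSeq.nonneg {u y : ℝ → ℝ} {e : ℕ → ℝ} (h : IsEventSeq u y e) (j : ℕ) : 0 ≤ e j := by
  have := (strictMono_nat_of_lt_succ h.lt).monotone (Nat.zero_le j)
  rwa [h.zero] at this

theorem IsTrajectory.exists_isEventSeq {g f : ℝ → ℝ} {α γ p lam d M : ℝ} {u y : ℝ → ℝ}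
    (hg : IsFluxInverse g p) (hf : IsMonotoneReaction f p M)
    (he : Exponents α γ p lam) (h : IsTrajectory g f α γ lam d u y) (hd : 0 < d) :
    ∃ e, IsEventSeq u y e := by
  -- The next event is chosen for every a, with a dummy value outside the admissible states, so that
  -- the sequence can be defined by plain recursion.
  have hnext : ∀ (j : ℕ) (a : ℝ), ∃ b, (0 ≤ a ∧ 0 < phase u y j a ∧ phase u y (j + 1) a = 0) →
      a < b ∧ (∀ r ∈ Ico a b, 0 < phase u y j r) ∧ phase u y j b = 0 ∧
      ∀ r ∈ Ioc a b, 0 < phase u y (j + 1) r := by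
    intro j a
    by_cases hs : 0 ≤ a ∧ 0 < phase u y j a ∧ phase u y (j + 1) a = 0
    · obtain ⟨b, hb⟩ := h.exists_next_event hg hf he hs.1 j hs.2.1 hs.2.2
      exact ⟨b, fun _ => hb⟩
    · exact ⟨0, fun hs' => absurd hs' hs⟩
  choose next hnext using hnext
  let e : ℕ → ℝ := fun n => Nat.rec 0 next n
  have hstep : ∀ j, e (j + 1) = next j (e j) := fun j => rfl
  have hstate : ∀ j, 0 ≤ e j ∧ 0 < phase u y j (e j) ∧ phase u y (j + 1) (e j) = 0 := by
    intro j
    induction j with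
    | zero =>
      refine ⟨le_rfl, ?_, ?_⟩
      · change 0 < u 0
        rwa [h.u_zero]
      · change -y 0 = 0
        rw [h.y_zero, neg_zero]
    | succ j ih =>
      obtain ⟨h1, h2, h3, h4⟩ := hnext j (e j) ih
      rw [← hstep] at h1 h3 h4
      refine ⟨ih.1.trans h1.le, h4 _ ⟨h1, le_rfl⟩, ?_⟩
      rw [phase_add_two, h3, neg_zero]
  exact ⟨e, rfl, fun j => (hnext j (e j) (hstate j)).1, fun j => (hnext j (e j) (hstate j)).2.1,
    fun j => (hnext j (e j) (hstate j)).2.2.1, fun j => (hnext j (e j) (hstate j)).2.2.2⟩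

theorem IsMonotoneReaction.picardData {g f : ℝ → ℝ} {α γ p lam M : ℝ} (hg : IsFluxInverse g p)
    (hf : IsMonotoneReaction f p M) (he : Exponents α γ p lam) :
    PicardData g f p (γ + 1 - α) γ lam M where
  inv := hg
  cont := hf.cont
  bound := hf.bound
  κ_pos := by linarith [he.le]
  nonneg := he.nonneg
  lam_nonneg := he.lam_pos.le

/-! ### Dependence on the initial value -/

/-- A family of solutions of the integral equation, indexed by the initial value. -/
structure IsSolutionFamily (g f : ℝ → ℝ) (α γ p lam M : ℝ) (u : ℝ → ℝ → ℝ) : Prop where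
  inv : IsFluxInverse g p
  reaction : IsMonotoneReaction f p M
  exps : Exponents α γ p lam
  cont : ∀ d, Continuous (u d)
  fixed : ∀ d, u d = delayedPicard g f (γ + 1 - α) γ lam 0 d (u d)

namespace IsSolutionFamily

variable {g f : ℝ → ℝ} {α γ p lam M : ℝ} {u : ℝ → ℝ → ℝ}

theorem picardData (h : IsSolutionFamily g f α γ p lam M u) :
    PicardData g f p (γ + 1 - α) γ lam M :=
  IsMonotoneReaction.picardData h.inv h.reaction h.exps

theorem isTrajectory (h : IsSolutionFamily g f α γ p lam M u) (d : ℝ) :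
    IsTrajectory g f α γ lam d (u d) (flux f γ lam (u d)) :=
  h.picardData.isTrajectory (h.cont d) (h.fixed d)

/-- Any sequence of initial values tending to d₀ has a subsequence whose solutions converge to a
solution starting at d₀, and uniqueness identifies the limit. -/
theorem tendsto_apply (h : IsSolutionFamily g f α γ p lam M u) {d₀ : ℝ} (hd₀ : d₀ ≠ 0) {r : ℝ}
    (hr : 0 ≤ r) : Tendsto (fun d => u d r) (𝓝 d₀) (𝓝 (u d₀ r)) := by
  apply tendsto_of_subseq_tendsto
  intro ns hns
  obtain ⟨ψ, w, -, hw, hlim, hfix⟩ := h.picardData.exists_subseq_tendsto_fixed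
    (fun n => h.cont (ns n)) (ε := fun _ => 0) (b := fun n => n) hns (fun _ => le_rfl)
    tendsto_const_nhds tendsto_natCast_atTop_atTop
    (fun n r _ => congrFun (h.fixed (ns n)) r)
  have huniq := (h.isTrajectory d₀).unique h.inv h.reaction.toIsReaction h.exps
    (h.picardData.isTrajectory hw hfix) hd₀ hr
  exact ⟨ψ, by
    rw [huniq]
    exact hlim r⟩

theorem tendsto_flux (h : IsSolutionFamily g f α γ p lam M u) {d₀ : ℝ} (hd₀ : d₀ ≠ 0) {r : ℝ}
    (hr : 0 ≤ r) :
    Tendsto (fun d => flux f γ lam (u d) r) (𝓝 d₀) (𝓝 (flux f γ lam (u d₀) r)) := by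
  apply Tendsto.neg
  apply Tendsto.const_mul
  have hpow : Continuous fun t : ℝ => t ^ γ := Real.continuous_rpow_const h.exps.nonneg
  apply intervalIntegral.tendsto_integral_filter_of_dominated_convergence (fun t => |t ^ γ| * M)
  · exact Eventually.of_forall fun d =>
      (hpow.mul (h.reaction.cont.comp (h.cont d))).aestronglyMeasurable
  · refine Eventually.of_forall fun d => Eventually.of_forall fun t _ => ?_
    rw [norm_mul, Real.norm_eq_abs, Real.norm_eq_abs]
    gcongr
    exact h.reaction.bound _
  · exact (hpow.abs.mul continuous_const).intervalIntegrable _ _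
  · refine Eventually.of_forall fun t ht => ?_
    rw [uIoc_of_le hr] at ht
    exact ((h.reaction.cont.tendsto _).comp (h.tendsto_apply hd₀ ht.1.le)).const_mul _

theorem tendsto_phase (h : IsSolutionFamily g f α γ p lam M u) {d₀ : ℝ} (hd₀ : d₀ ≠ 0) (j : ℕ)
    {r : ℝ} (hr : 0 ≤ r) :
    Tendsto (fun d => phase (u d) (flux f γ lam (u d)) j r) (𝓝 d₀)
      (𝓝 (phase (u d₀) (flux f γ lam (u d₀)) j r)) := by
  induction j using Nat.twoStepInduction with
  | zero => exact h.tendsto_apply hd₀ hr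
  | one => exact (h.tendsto_flux hd₀ hr).neg
  | more j ih _ => exact ih.neg

theorem abs_flux_sub_le (h : IsSolutionFamily g f α γ p lam M u) (d : ℝ) {r s b : ℝ}
    (hr : r ∈ Icc 0 b) (hs : s ∈ Icc 0 b) :
    |flux f γ lam (u d) r - flux f γ lam (u d) s| ≤ lam * b ^ γ * M * |r - s| := by
  wlog hsr : s ≤ r generalizing r s
  · rw [abs_sub_comm, abs_sub_comm r]
    exact this hs hr (le_of_not_ge hsr)
  rw [abs_of_nonneg (sub_nonneg.2 hsr)]
  have hd := fun q => h.picardData.hasDerivAt_flux (h.cont d) q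
  refine abs_sub_le_of_hasDerivAt hsr (fun q _ => (hd q).continuousAt.continuousWithinAt)
    (fun q _ => hd q) fun q hq => ?_
  have hq0 : 0 ≤ q := hs.1.trans hq.1.le
  have hlam := h.exps.lam_pos
  have hγ := h.exps.nonneg
  have h1 : 0 ≤ lam * q ^ γ := by positivity
  rw [abs_neg, abs_mul, abs_of_nonneg h1]
  have := h.reaction.bound (u d q)
  have : q ≤ b := hq.2.le.trans hr.2
  have : 0 ≤ b := hq0.trans this
  gcongr

/-- The point is that L does not depend on d, which upgrades continuity in d at fixed times to joint
continuity. -/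
theorem exists_lipschitz_phase (h : IsSolutionFamily g f α γ p lam M u) (j : ℕ) (b : ℝ) :
    ∃ L, ∀ d, ∀ r ∈ Icc 0 b, ∀ s ∈ Icc 0 b,
      |phase (u d) (flux f γ lam (u d)) j r - phase (u d) (flux f γ lam (u d)) j s| ≤
        L * |r - s| := by
  induction j using Nat.twoStepInduction with
  | zero =>
    refine ⟨g (lam * M * b ^ (γ + 1 - α)), fun d r hr s hs => ?_⟩
    have := h.picardData.abs_delayedPicard_sub_le (h.cont d) 0 d hr.2 hs.2 (hr.1.trans hr.2)
    rwa [← h.fixed] at this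
  | one =>
    refine ⟨lam * b ^ γ * M, fun d r hr s hs => ?_⟩
    simp only [phase]
    rw [← neg_sub', abs_neg]
    exact h.abs_flux_sub_le d hr hs
  | more j ih _ =>
    obtain ⟨L, hL⟩ := ih
    refine ⟨L, fun d r hr s hs => ?_⟩
    rw [phase_add_two, phase_add_two, ← neg_sub', abs_neg]
    exact hL d r hr s hs

/-- The phase functions are jointly continuous in the initial value and in time. -/
theorem tendsto_phase_apply (h : IsSolutionFamily g f α γ p lam M u) {d₀ : ℝ} (hd₀ : d₀ ≠ 0)
    (j : ℕ) {l : Filter ℝ} (hl : l ≤ 𝓝 d₀) {ρ : ℝ → ℝ} {r : ℝ} (hr : 0 ≤ r)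
    (hρ0 : ∀ᶠ d in l, 0 ≤ ρ d) (hρ : Tendsto ρ l (𝓝 r)) :
    Tendsto (fun d => phase (u d) (flux f γ lam (u d)) j (ρ d)) l
      (𝓝 (phase (u d₀) (flux f γ lam (u d₀)) j r)) := by
  obtain ⟨L, hL⟩ := h.exists_lipschitz_phase j (r + 1)
  have h1 := (h.tendsto_phase hd₀ j hr).mono_left hl
  have h2 : Tendsto (fun d => phase (u d) (flux f γ lam (u d)) j (ρ d) -
      phase (u d) (flux f γ lam (u d)) j r) l (𝓝 0) := by
    have hz : Tendsto (fun d => L * |ρ d - r|) l (𝓝 0) := by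
      have := ((hρ.sub_const r).abs).const_mul L
      simpa using this
    refine squeeze_zero_norm' ?_ hz
    filter_upwards [hρ0, hρ.eventually (gt_mem_nhds (lt_add_one r))] with d hd0 hd1
    exact hL d _ ⟨hd0, hd1.le⟩ _ ⟨hr, by linarith⟩
  have := h2.add h1
  simpa using this

/-- The event times depend continuously on the initial value. -/
theorem tendsto_event (h : IsSolutionFamily g f α γ p lam M u) {e : ℝ → ℕ → ℝ}
    (hev : ∀ d, 0 < d → IsEventSeq (u d) (flux f γ lam (u d)) (e d)) {d₀ : ℝ} (hd₀ : 0 < d₀)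
    (j : ℕ) : Tendsto (fun d => e d j) (𝓝 d₀) (𝓝 (e d₀ j)) := by
  have hpos : ∀ᶠ d in 𝓝 d₀, 0 < d := lt_mem_nhds hd₀
  induction j with
  | zero =>
    rw [(hev d₀ hd₀).zero]
    refine tendsto_const_nhds.congr' ?_
    filter_upwards [hpos] with d hd using (hev d hd).zero.symm
  | succ j ih =>
    -- Just after its zero, phase j of the limit solution is strictly negative, hence so is that of
    -- nearby solutions, whose event j + 1 must therefore already have occurred.
    have hupper : ∀ r ∈ Ioc (e d₀ (j + 1)) (e d₀ (j + 2)), ∀ᶠ d in 𝓝 d₀, e d (j + 1) ≤ r := by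
      intro r hr
      have hr0 : 0 ≤ r := ((hev d₀ hd₀).nonneg (j + 1)).trans hr.1.le
      have hneg : phase (u d₀) (flux f γ lam (u d₀)) j r < 0 := by
        have := (hev d₀ hd₀).pos_succ (j + 1) r hr
        rw [phase_add_two] at this
        linarith
      filter_upwards [hpos, (h.tendsto_phase hd₀.ne' j hr0).eventually (gt_mem_nhds hneg),
        ih.eventually (gt_mem_nhds (((hev d₀ hd₀).lt j).trans hr.1))] with d h1 h2 h3
      by_contra hlt
      have := (hev d h1).pos j r ⟨h3.le, not_le.1 hlt⟩
      linarith
    -- Along an ultrafilter the bounded event times converge. Their limit is a zero of phase j in [e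
    -- d₀ j, e d₀ (j + 1)], and the right endpoint is the only one.
    rw [tendsto_iff_ultrafilter]
    intro U hU
    have hlt := (hev d₀ hd₀).lt (j + 1)
    have hmem : ∀ᶠ d in (U : Filter ℝ), e d (j + 1) ∈ Icc 0 (e d₀ (j + 2)) := by
      filter_upwards [hU hpos, hU (hupper _ ⟨hlt, le_rfl⟩)] with d h1 h2
      exact ⟨(hev d h1).nonneg _, h2⟩
    obtain ⟨r, hr, hUr⟩ := isCompact_Icc.ultrafilter_le_nhds
      (U.map fun d => e d (j + 1)) (le_principal_iff.2 hmem)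
    have hlim : Tendsto (fun d => e d (j + 1)) U (𝓝 r) := hUr
    have hr1 : r ≤ e d₀ (j + 1) := by
      by_contra hcon
      push Not at hcon
      obtain ⟨q, hq1, hq2⟩ := exists_between (lt_min hcon hlt)
      have hq3 := hq2.trans_le (min_le_left _ _)
      have hq4 := hq2.trans_le (min_le_right _ _)
      have := le_of_tendsto hlim (hU (hupper q ⟨hq1, hq4.le⟩))
      linarith
    have hr2 : e d₀ j ≤ r := by
      refine le_of_tendsto_of_tendsto (ih.mono_left hU) hlim ?_
      filter_upwards [hU hpos] with d h1 using ((hev d h1).lt j).le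
    have hzero : phase (u d₀) (flux f γ lam (u d₀)) j r = 0 := by
      refine tendsto_nhds_unique (h.tendsto_phase_apply hd₀.ne' j hU hr.1 ?_ hlim) ?_
      · filter_upwards [hmem] with d h1 using h1.1
      · refine tendsto_const_nhds.congr' ?_
        filter_upwards [hU hpos] with d h1 using ((hev d h1).eq_zero j).symm
    have heq : r = e d₀ (j + 1) := by
      by_contra hne
      have := (hev d₀ hd₀).pos j r ⟨hr2, lt_of_le_of_ne hr1 hne⟩
      linarith
    rw [← heq]
    exact hlim

/-- Small initial values give small solutions. -/
theorem eventually_abs_lt (h : IsSolutionFamily g f α γ p lam M u) {η : ℝ} (hη : 0 < η) :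
    ∀ᶠ d in 𝓝[>] (0 : ℝ), ∀ r, 0 ≤ r → |u d r| < η := by
  have hF := continuous_primitive h.reaction.cont
  have hmp := h.reaction.mul_pos
  have h1 := primitive_pos_of_ne h.reaction.cont hmp hη.ne'
  have h2 := primitive_pos_of_ne h.reaction.cont hmp (neg_ne_zero.2 hη.ne')
  have hlim : Tendsto (primitive f) (𝓝[>] 0) (𝓝 0) := by
    have := (hF.tendsto 0).mono_left (nhdsWithin_le_nhds (s := Ioi 0))
    rwa [primitive_zero] at this
  filter_upwards [hlim.eventually (gt_mem_nhds (lt_min h1 h2))] with d hd r hr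
  have h3 := (h.isTrajectory d).primitive_le h.inv h.reaction.cont h.exps hr
  rw [abs_lt]
  constructor
  · by_contra hcon
    have := (primitive_strictAntiOn h.reaction.cont hmp).antitoneOn
      (mem_Iic.2 (by linarith : u d r ≤ 0)) (mem_Iic.2 (by linarith : -η ≤ 0)) (not_lt.1 hcon)
    linarith [min_le_right (primitive f η) (primitive f (-η))]
  · by_contra hcon
    have := (primitive_strictMonoOn h.reaction.cont hmp).monotoneOn
      (mem_Ici.2 hη.le) (mem_Ici.2 (by linarith : 0 ≤ u d r)) (not_lt.1 hcon)
    linarith [min_le_left (primitive f η) (primitive f (-η))]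

/-- For small d the solution is uniformly small, hence so is Ψ(u), while the crossing speed for
phases of length at least ε does not depend on d. -/
theorem eventually_event_lt (h : IsSolutionFamily g f α γ p lam M u) {e : ℝ → ℕ → ℝ}
    (hev : ∀ d, 0 < d → IsEventSeq (u d) (flux f γ lam (u d)) (e d)) {ε : ℝ} (hε : 0 < ε) :
    ∀ᶠ d in 𝓝[>] (0 : ℝ), ∀ j, e d (j + 1) - e d j < ε := by
  have hC := IsTrajectory.crossingSpeed_pos h.inv h.reaction h.exps hε
  set C := crossingSpeed g α γ p lam M ε with hCdef
  have hΨ := h.reaction.continuous_crossingPotential.tendsto 0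
  have hΨ0 : crossingPotential f p 0 = 0 := intervalIntegral.integral_same
  rw [hΨ0, Metric.tendsto_nhds_nhds] at hΨ
  -- With |Ψ(u)| ≤ Cε/12, a phase of length at least ε would satisfy Cε ≤ 6 · Cε/12 = Cε/2.
  obtain ⟨η, hη, hsmall⟩ := hΨ (C * ε / 12) (by positivity)
  filter_upwards [h.eventually_abs_lt hη, self_mem_nhdsWithin] with d hd hd0 j
  have hev' := hev d hd0
  by_contra hcon
  have := ((h.isTrajectory d).phase_duration h.inv h.reaction h.exps (hev'.nonneg j) (hev'.lt j) j
    (fun r hr => hev'.pos j r ⟨hr.1.le, hr.2⟩) (by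
      cases j with
      | zero =>
        change -flux f γ lam (u d) (e d 0) = 0
        rw [hev'.zero, (h.isTrajectory d).y_zero, neg_zero]
      | succ j => rw [phase_add_two, hev'.eq_zero, neg_zero])).2 ε (C * ε / 12) hε (not_lt.1 hcon)
    (fun r hr => by
      have h1 := hd r ((hev'.nonneg j).trans hr.1)
      have h2 := @hsmall (u d r) (by rwa [Real.dist_eq, sub_zero])
      rw [Real.dist_eq, sub_zero] at h2
      exact h2.le)
  have h3 : C * ε ≤ C * (e d (j + 1) - e d j) := by
    gcongr
    exact not_lt.1 hcon
  have h4 : 0 < C * ε := by positivity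
  linarith

theorem tendsto_event_zero (h : IsSolutionFamily g f α γ p lam M u) {e : ℝ → ℕ → ℝ}
    (hev : ∀ d, 0 < d → IsEventSeq (u d) (flux f γ lam (u d)) (e d)) (j : ℕ) :
    Tendsto (fun d => e d j) (𝓝[>] 0) (𝓝 0) := by
  induction j with
  | zero =>
    refine tendsto_const_nhds.congr' ?_
    filter_upwards [self_mem_nhdsWithin] with d hd using (hev d hd).zero.symm
  | succ j ih =>
    have hdiff : Tendsto (fun d => e d (j + 1) - e d j) (𝓝[>] 0) (𝓝 0) := by
      rw [Metric.tendsto_nhds]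
      intro ε hε
      filter_upwards [h.eventually_event_lt hev hε, self_mem_nhdsWithin] with d hd hd0
      rw [Real.dist_eq, sub_zero, abs_of_pos (sub_pos.2 ((hev d hd0).lt j))]
      exact hd j
    have := hdiff.add ih
    simpa using this

end IsSolutionFamily

/-! ### Counting zeros -/

theorem phase_two_mul (u y : ℝ → ℝ) (k : ℕ) (r : ℝ) : phase u y (2 * k) r = (-1) ^ k * u r := by
  induction k with
  | zero => simp [phase]
  | succ k ih =>
    rw [mul_add, mul_one, phase_add_two, ih]
    ring

theorem phase_two_mul_add_one (u y : ℝ → ℝ) (k : ℕ) (r : ℝ) :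
    phase u y (2 * k + 1) r = (-1) ^ k * -y r := by
  induction k with
  | zero => simp [phase]
  | succ k ih =>
    rw [show 2 * (k + 1) + 1 = 2 * k + 1 + 2 by ring, phase_add_two, ih]
    ring

namespace IsEventSeq

variable {u y : ℝ → ℝ} {e : ℕ → ℝ}

theorem strictMono (h : IsEventSeq u y e) : StrictMono e := strictMono_nat_of_lt_succ h.lt

theorem u_eq_zero (h : IsEventSeq u y e) (k : ℕ) : u (e (2 * k + 1)) = 0 := by
  have := h.eq_zero (2 * k)
  rw [phase_two_mul] at this
  simpa using this

theorem y_ne_zero (h : IsEventSeq u y e) (k : ℕ) : y (e (2 * k + 1)) ≠ 0 := by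
  have := h.pos_succ (2 * k) (e (2 * k + 1)) ⟨h.lt _, le_rfl⟩
  rw [phase_two_mul_add_one] at this
  intro h0
  simp [h0] at this

theorem u_ne_zero (h : IsEventSeq u y e) (k : ℕ) {r : ℝ}
    (hr : r ∈ Ioo (e (2 * k + 1)) (e (2 * k + 3))) : u r ≠ 0 := by
  -- Between consecutive zeros lies one event where the flux vanishes; phase 2k + 2, which is ±u, is
  -- positive on both sides of it and at it.
  have hpos : 0 < phase u y (2 * (k + 1)) r := by
    rcases le_total r (e (2 * k + 2)) with hle | hle
    · exact h.pos_succ (2 * k + 1) r ⟨hr.1, hle⟩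
    · exact h.pos (2 * k + 2) r ⟨hle, hr.2⟩
  rw [phase_two_mul] at hpos
  intro h0
  simp [h0] at hpos

theorem exists_of_u_eq_zero (h : IsEventSeq u y e) (n : ℕ) {r : ℝ} (hr0 : 0 < r)
    (hr : r < e (2 * n + 1)) (hu : u r = 0) : ∃ i < n, e (2 * i + 1) = r := by
  induction n with
  | zero =>
    have := h.pos 0 r ⟨by rw [h.zero]; exact hr0.le, hr⟩
    change 0 < u r at this
    linarith
  | succ n ih =>
    rcases lt_trichotomy r (e (2 * n + 1)) with hlt | heq | hgt
    · obtain ⟨i, hi, hir⟩ := ih hlt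
      exact ⟨i, by omega, hir⟩
    · exact ⟨n, by omega, heq.symm⟩
    · exact absurd hu (h.u_ne_zero n ⟨hgt, hr⟩)

theorem strictMono_odd (h : IsEventSeq u y e) : StrictMono fun i => e (2 * i + 1) :=
  fun i j hij => h.strictMono (by omega)

theorem encard_zerosIn_le (h : IsEventSeq u y e) {R : ℝ} {n : ℕ} (hR : R ≤ e (2 * n + 1)) :
    (zerosIn u R).encard ≤ n := by
  have hsub : zerosIn u R ⊆ (fun i => e (2 * i + 1)) '' (Finset.range n : Set ℕ) := by
    rintro r ⟨hr, hu⟩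
    obtain ⟨i, hi, hir⟩ := h.exists_of_u_eq_zero n hr.1 (hr.2.trans_le hR) hu
    exact ⟨i, by simpa using hi, hir⟩
  refine (encard_le_encard hsub).trans ((encard_image_le _ _).trans ?_)
  rw [encard_coe_eq_coe_finsetCard, Finset.card_range]

theorem le_encard_zerosIn (h : IsEventSeq u y e) {R : ℝ} {n : ℕ} (hR : e (2 * n + 1) < R) :
    ((n + 1 : ℕ) : ℕ∞) ≤ (zerosIn u R).encard := by
  have hsub : (fun i => e (2 * i + 1)) '' (Finset.range (n + 1) : Set ℕ) ⊆ zerosIn u R := by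
    rintro _ ⟨i, hi, rfl⟩
    have hi' : i ≤ n := by
      have : i < n + 1 := by simpa using hi
      omega
    refine ⟨⟨?_, ?_⟩, h.u_eq_zero i⟩
    · exact (h.nonneg (2 * i)).trans_lt (h.lt _)
    · exact (h.strictMono_odd.monotone hi').trans_lt hR
  refine le_trans (le_of_eq ?_) (encard_le_encard hsub)
  rw [h.strictMono_odd.injective.encard_image, encard_coe_eq_coe_finsetCard, Finset.card_range]

end IsEventSeq

/-! ### Radial solutions and trajectories -/

/-- Radial solutions are trajectories of the first-order system. -/
theorem IsRadialSolution.isTrajectory {φ f g : ℝ → ℝ} {α γ lam d : ℝ} {v : ℝ → ℝ}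
    (hg : StrictMono g) (hgφ : ∀ t, g (φ |t| * t) = t) (hφg : ∀ s, φ |g s| * g s = s)
    (h : IsRadialSolution φ f α γ lam d v) :
    IsTrajectory g f α γ lam d v
      (fun r => if r ≤ 0 then 0 else r ^ α * (φ |deriv v r| * deriv v r)) := by
  have hdiff : ∀ r, 0 < r → HasDerivAt v (deriv v r) r := fun r hr =>
    ((h.contDiffOn.differentiableOn one_ne_zero).differentiableAt (Ici_mem_nhds hr)).hasDerivAt
  have heq : ∀ r, 0 < r → (fun r => if r ≤ 0 then 0 else r ^ α * (φ |deriv v r| * deriv v r))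
      =ᶠ[𝓝 r] fun r => r ^ α * (φ |deriv v r| * deriv v r) := by
    intro r hr
    filter_upwards [lt_mem_nhds hr] with s hs
    rw [if_neg (not_le.2 hs)]
  have hderiv : ∀ r, 0 < r →
      HasDerivAt (fun r => if r ≤ 0 then 0 else r ^ α * (φ |deriv v r| * deriv v r))
        (-(lam * r ^ γ * f (v r))) r := fun r hr =>
    (h.equation r hr).congr_of_eventuallyEq (heq r hr)
  have hmono : Monotone fun t => φ |t| * t := fun a b hab => by
    rw [← hg.le_iff_le, hgφ, hgφ]
    exact hab
  -- A monotone surjection is continuous; this covers t = 0, where φ itself is not controlled.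
  have hcont : Continuous fun t => φ |t| * t :=
    hmono.continuous_of_surjective fun s => ⟨g s, hφg s⟩
  have hlim : Tendsto (fun r => r ^ α * (φ |deriv v r| * deriv v r)) (𝓝[>] 0) (𝓝 0) := by
    rcases lt_or_ge α 0 with hα | hα
    · exact h.flux_zero hα
    have h1 : Tendsto (deriv v) (𝓝[>] 0) (𝓝 0) := by
      have h2 := (h.contDiffOn.continuousOn_derivWithin (uniqueDiffOn_Ici 0) le_rfl) 0 self_mem_Ici
      rw [ContinuousWithinAt, h.init_deriv.derivWithin (uniqueDiffOn_Ici 0 0 self_mem_Ici)] at h2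
      refine (h2.mono_left (nhdsWithin_mono _ Ioi_subset_Ici_self)).congr' ?_
      filter_upwards [self_mem_nhdsWithin] with r hr
      exact derivWithin_of_mem_nhds (Ici_mem_nhds hr)
    have h3 : Tendsto (fun r => φ |deriv v r| * deriv v r) (𝓝[>] 0) (𝓝 0) := by
      have := (hcont.tendsto 0).comp h1
      rwa [mul_zero] at this
    refine squeeze_zero_norm' ?_ (h3.abs.trans (by simp))
    filter_upwards [Ioc_mem_nhdsGT (zero_lt_one (α := ℝ))] with r hr
    rw [Real.norm_eq_abs, abs_mul, abs_of_nonneg (Real.rpow_nonneg hr.1.le _)]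
    exact mul_le_of_le_one_left (abs_nonneg _) (Real.rpow_le_one hr.1.le hr.2 hα)
  refine ⟨h.contDiffOn.continuousOn, ?_, h.init, if_pos le_rfl, fun r hr => ?_, hderiv⟩
  · intro r hr
    rcases (mem_Ici.1 hr).eq_or_lt with h0 | h0
    · subst h0
      rw [ContinuousWithinAt, if_pos le_rfl, ← Ioi_insert, nhdsWithin_insert, tendsto_sup]
      refine ⟨tendsto_pure_left.2 fun s hs => ?_, hlim.congr' ?_⟩
      · rw [if_pos le_rfl]
        exact mem_of_mem_nhds hs
      · filter_upwards [self_mem_nhdsWithin] with s hs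
        rw [if_neg (not_le.2 hs)]
    · exact (hderiv r h0).continuousAt.continuousWithinAt
  · simp only [if_neg (not_le.2 hr)]
    rw [← mul_assoc, ← Real.rpow_add hr, neg_add_cancel, Real.rpow_zero, one_mul, hgφ]
    exact hdiff r hr

theorem IsTrajectory.congr_reaction {g f f' : ℝ → ℝ} {α γ lam d : ℝ} {u y : ℝ → ℝ}
    (h : IsTrajectory g f α γ lam d u y) (hff : ∀ r, 0 < r → f (u r) = f' (u r)) :
    IsTrajectory g f' α γ lam d u y :=
  { h with deriv_y := fun r hr => hff r hr ▸ h.deriv_y r hr }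

theorem IsSolutionFamily.deriv_eq {g f : ℝ → ℝ} {α γ p lam M : ℝ} {u : ℝ → ℝ → ℝ}
    (h : IsSolutionFamily g f α γ p lam M u) (d : ℝ) {r : ℝ} (hr : 0 < r) :
    deriv (u d) r = g (r ^ (-α) * flux f γ lam (u d) r) :=
  ((h.isTrajectory d).deriv_u r hr).deriv

theorem IsSolutionFamily.isRadialSolution {φ g f f' : ℝ → ℝ} {α γ p lam M d : ℝ} {u : ℝ → ℝ → ℝ}
    (hφg : ∀ s, φ |g s| * g s = s) (h : IsSolutionFamily g f α γ p lam M u)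
    (hff : ∀ r, 0 < r → f (u d r) = f' (u d r)) : IsRadialSolution φ f' α γ lam d (u d) := by
  have hT := h.isTrajectory d
  have hd : ∀ r, HasDerivAt (u d) (g (delayedFlux f (γ + 1 - α) γ lam 0 (u d) r)) r := by
    intro r
    have := h.picardData.hasDerivAt_delayedPicard (h.cont d) 0 d r
    rwa [← h.fixed] at this
  have hderiv : deriv (u d) = fun r => g (delayedFlux f (γ + 1 - α) γ lam 0 (u d) r) :=
    funext fun r => (hd r).deriv
  have hflux : ∀ s, 0 < s →
      s ^ α * (φ |deriv (u d) s| * deriv (u d) s) = flux f γ lam (u d) s := by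
    intro s hs
    rw [h.deriv_eq d hs, hφg, ← mul_assoc, ← Real.rpow_add hs, add_neg_cancel, Real.rpow_zero,
      one_mul]
  refine ⟨?_, hT.u_zero, ?_, fun _ => ?_, fun r hr => ?_⟩
  · apply ContDiff.contDiffOn
    rw [contDiff_one_iff_deriv, hderiv]
    exact ⟨fun r => (hd r).differentiableAt,
      h.inv.cont.comp (h.picardData.continuous_delayedFlux (h.cont d) 0)⟩
  · have := hd 0
    rw [h.picardData.delayedFlux_of_nonpos _ _ le_rfl, h.inv.map_zero] at this
    exact this.hasDerivWithinAt
  · have h1 := (hT.cont_y 0 self_mem_Ici).mono Ioi_subset_Ici_self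
    rw [ContinuousWithinAt, hT.y_zero] at h1
    refine h1.congr' ?_
    filter_upwards [self_mem_nhdsWithin] with s hs using (hflux s hs).symm
  · rw [← hff r hr]
    refine (hT.deriv_y r hr).congr_of_eventuallyEq ?_
    filter_upwards [lt_mem_nhds hr] with s hs using hflux s hs

/-! ### Truncation to the potential well and the first zero -/

/-- The truncation of `f` outside `[-B, D]`. -/
def truncated (f : ℝ → ℝ) (B D t : ℝ) : ℝ := f (max (-B) (min t D))

theorem truncated_eq {f : ℝ → ℝ} {B D t : ℝ} (h : t ∈ Icc (-B) D) : truncated f B D t = f t := by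
  rw [truncated, min_eq_left h.2, max_eq_right h.1]

theorem intervalIntegrable_of_continuousOn_compl {F : ℝ → ℝ} {η : ℝ} (hη : 0 < η)
    (hc : ContinuousOn F {0}ᶜ) (hi : IntegrableOn F (Ioo (-η) η)) (a b : ℝ) :
    IntervalIntegrable F volume a b := by
  have hsmall : ∀ b ∈ Ioo (-η) η, IntervalIntegrable F volume 0 b := by
    intro b hb
    rw [intervalIntegrable_iff]
    refine hi.mono_set fun t ht => ?_
    rw [mem_uIoc] at ht
    rcases ht with ht | ht
    · exact ⟨by linarith [ht.1], ht.2.trans_lt hb.2⟩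
    · exact ⟨hb.1.trans ht.1, ht.2.trans_lt hη⟩
  have hzero : ∀ b, IntervalIntegrable F volume 0 b := by
    intro b
    have hfar : ∀ c, (0 < c ∧ 0 < b) ∨ (c < 0 ∧ b < 0) → IntervalIntegrable F volume c b := by
      intro c hcb
      apply ContinuousOn.intervalIntegrable
      refine hc.mono fun t ht h0 => ?_
      rw [mem_singleton_iff.1 h0, mem_uIcc] at ht
      rcases ht with ht | ht <;> rcases hcb with hcb | hcb <;> linarith [ht.1, ht.2, hcb.1, hcb.2]
    rcases lt_trichotomy b 0 with hb | hb | hb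
    · exact (hsmall (-(η / 2)) ⟨by linarith, by linarith⟩).trans
        (hfar _ (Or.inr ⟨by linarith, hb⟩))
    · rw [hb]
    · exact (hsmall (η / 2) ⟨by linarith, by linarith⟩).trans (hfar _ (Or.inl ⟨by positivity, hb⟩))
  exact (hzero a).symm.trans (hzero b)

theorem exists_isMonotoneReaction_truncated {f : ℝ → ℝ} {p B D : ℝ} (hB : 0 < B) (hD : 0 < D)
    (hf_cont : Continuous f) (hf_C1 : ContDiffOn ℝ 1 f {0}ᶜ) (hf₁ : ∀ t, t ≠ 0 → 0 < t * f t)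
    (hf₂ : MonotoneOn f (Iic D))
    (hf₃ : ∃ δ > 0, IntegrableOn (fun t => |f t| ^ (-1 / p)) (Ioo (-δ) δ)) :
    ∃ M, IsMonotoneReaction (truncated f B D) p M := by
  have hclip : Continuous fun t : ℝ => max (-B) (min t D) :=
    continuous_const.max (continuous_id.min continuous_const)
  have hcont : Continuous (truncated f B D) := hf_cont.comp hclip
  have hmem : ∀ t : ℝ, max (-B) (min t D) ∈ Icc (-B) D := fun t =>
    ⟨le_max_left _ _, max_le (by linarith) (min_le_right _ _)⟩
  have hclip_pos : ∀ t, 0 < t → 0 < max (-B) (min t D) := fun t ht =>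
    (lt_min ht hD).trans_le (le_max_right _ _)
  have hclip_neg : ∀ t, t < 0 → max (-B) (min t D) < 0 := fun t ht =>
    max_lt (by linarith) ((min_le_left _ _).trans_lt ht)
  have hpos : ∀ t, t ≠ 0 → 0 < t * truncated f B D t := by
    intro t ht
    rcases lt_or_gt_of_ne ht with h | h
    · have h1 := hclip_neg t h
      exact mul_pos_of_neg_of_neg h (neg_of_mul_pos_right (hf₁ _ h1.ne) h1.le)
    · have h1 := hclip_pos t h
      exact mul_pos h (pos_of_mul_pos_right (hf₁ _ h1.ne') h1.le)
  obtain ⟨M, hM⟩ := isCompact_Icc.exists_bound_of_continuousOn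
    (hf_cont.continuousOn (s := Icc (-B) D))
  refine ⟨M, ⟨hcont, hpos, fun t ht => ?_⟩, fun s t hst => ?_, fun t => hM _ (hmem t), ?_⟩
  · have hc0 : max (-B) (min t D) ≠ 0 := by
      rcases lt_or_gt_of_ne ht with h | h
      · exact (hclip_neg t h).ne
      · exact (hclip_pos t h).ne'
    -- Clipping is 1-Lipschitz and sends nonzero points to nonzero points, so the local Lipschitz
    -- bound of f at the clipped point transfers.
    obtain ⟨K, s, hs, hK⟩ := (hf_C1.contDiffAt
      (isOpen_compl_singleton.mem_nhds hc0)).exists_lipschitzOnWith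
    obtain ⟨ε, hε, hball⟩ := Metric.mem_nhds_iff.1 hs
    have habs : ∀ a b : ℝ, |max (-B) (min a D) - max (-B) (min b D)| ≤ |a - b| := fun a b => by
      refine (abs_max_sub_max_le_max _ _ _ _).trans ?_
      rw [sub_self, abs_zero, max_eq_right (abs_nonneg _)]
      refine (abs_min_sub_min_le_max _ _ _ _).trans ?_
      rw [sub_self, abs_zero, max_eq_left (abs_nonneg _)]
    refine ⟨K, K.2, ε, hε, fun a b ha hb => ?_⟩
    have h1 := hK.dist_le_mul _ (hball (Metric.mem_ball.2 ((habs a t).trans_lt ha)))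
      _ (hball (Metric.mem_ball.2 ((habs b t).trans_lt hb)))
    rw [Real.dist_eq, Real.dist_eq] at h1
    exact h1.trans (mul_le_mul_of_nonneg_left (habs a b) K.2)
  · exact hf₂ (hmem s).2 (hmem t).2 (max_le_max le_rfl (min_le_min hst le_rfl))
  · obtain ⟨δ, hδ, hint⟩ := hf₃
    -- On this neighbourhood of 0 the truncation does nothing, so the integrability of the original
    -- f applies; elsewhere the integrand is continuous.
    refine intervalIntegrable_of_continuousOn_compl (η := min δ (min B D))
      (lt_min hδ (lt_min hB hD)) ?_ ?_
    · intro t ht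
      refine (hcont.abs.continuousAt.rpow_const (Or.inl ?_)).continuousWithinAt
      intro h0
      have := hpos t ht
      rw [abs_eq_zero.1 h0, mul_zero] at this
      exact this.false
    · refine (hint.mono_set (Ioo_subset_Ioo ?_ ?_)).congr_fun ?_ measurableSet_Ioo
      · exact neg_le_neg (min_le_left _ _)
      · exact min_le_left _ _
      · intro t ht
        have h1 : t < B := ht.2.trans_le ((min_le_right _ _).trans (min_le_left _ _))
        have h2 : t < D := ht.2.trans_le ((min_le_right _ _).trans (min_le_right _ _))
        have h3 : min δ (min B D) ≤ B := (min_le_right _ _).trans (min_le_left _ _)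
        simp only
        rw [truncated_eq ⟨by linarith [ht.1], h2.le⟩]

theorem exists_primitive_le_primitive_neg {f : ℝ → ℝ} {D : ℝ} (hD : 0 < D)
    (hf_cont : Continuous f) (hf₁ : ∀ t, t ≠ 0 → 0 < t * f t) (hf₂ : MonotoneOn f (Iic D)) :
    ∃ B > 0, primitive f D ≤ primitive f (-B) := by
  have h1 : f (-1) < 0 := by
    have := hf₁ (-1) (by norm_num)
    linarith
  have hFD := primitive_pos_of_ne hf_cont hf₁ hD.ne'
  have hF1 := primitive_pos_of_ne hf_cont hf₁ (by norm_num : (-1 : ℝ) ≠ 0)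
  -- On (-∞, -1] the slope of F is at most f(-1) < 0, so moving left from -1 by F(D)/|f(-1)| raises
  -- F by at least F(D).
  set B := 1 + primitive f D / -f (-1) with hB
  have hB1 : 0 < primitive f D / -f (-1) := div_pos hFD (by linarith)
  refine ⟨B, by linarith, ?_⟩
  have key := sub_le_sub_of_hasDerivAt_le (a := -B) (b := -1) (P := primitive f) (P' := f)
    (Q := fun s => f (-1) * s) (Q' := fun _ => f (-1)) (by linarith)
    (continuous_primitive hf_cont).continuousOn (continuous_const.mul continuous_id).continuousOn
    (fun q _ => hasDerivAt_primitive hf_cont q)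
    (fun q _ => by simpa using (hasDerivAt_id q).const_mul (f (-1)))
    (fun q hq => hf₂ (mem_Iic.2 (by linarith [hq.2])) (mem_Iic.2 (by linarith)) hq.2.le)
  have h2 : f (-1) * -1 - f (-1) * -B = primitive f D * (-1) := by
    have h3 := h1.ne
    rw [hB]
    field_simp
    ring
  linarith

/-- The potential well `{F ≤ F(d)}` with `d ≤ D` is contained in `[-B, D]`. -/
theorem mem_Icc_of_primitive_le {f : ℝ → ℝ} {B D d t : ℝ} (hf_cont : Continuous f)
    (hf₁ : ∀ t, t ≠ 0 → 0 < t * f t) (hB : 0 < B) (hBD : primitive f D ≤ primitive f (-B))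
    (hd : d ∈ Ioc 0 D) (ht : primitive f t ≤ primitive f d) : t ∈ Icc (-B) D := by
  have hmono := primitive_strictMonoOn hf_cont hf₁
  have hdD : primitive f d ≤ primitive f D :=
    hmono.monotoneOn (mem_Ici.2 hd.1.le) (mem_Ici.2 (hd.1.le.trans hd.2)) hd.2
  constructor
  · by_contra h
    have := primitive_strictAntiOn hf_cont hf₁ (mem_Iic.2 (by linarith : t ≤ 0))
      (mem_Iic.2 (by linarith : -B ≤ 0)) (not_le.1 h)
    linarith
  · by_contra h
    have h1 := not_le.1 h
    have := hmono (mem_Ici.2 (hd.1.le.trans hd.2)) (mem_Ici.2 ((hd.1.le.trans hd.2).trans h1.le)) h1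
    linarith

theorem primitive_truncated {f : ℝ → ℝ} {B D t : ℝ} (hB : 0 ≤ B) (hD : 0 ≤ D)
    (ht : t ∈ Icc (-B) D) : primitive (truncated f B D) t = primitive f t := by
  apply intervalIntegral.integral_congr
  intro s hs
  apply truncated_eq
  rw [mem_uIcc] at hs
  rcases hs with hs | hs
  · exact ⟨by linarith [hs.1], hs.2.trans ht.2⟩
  · exact ⟨ht.1.trans hs.1, hs.2.trans hD⟩

/-- On [0, R] the slope of u is at most g(λ M R^(γ+1-α)) in absolute value, so u cannot descend from
d to 0 before time R. -/
theorem IsSolutionFamily.le_first_event {g f : ℝ → ℝ} {α γ p lam M d R : ℝ} {u : ℝ → ℝ → ℝ}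
    {e : ℕ → ℝ} (h : IsSolutionFamily g f α γ p lam M u)
    (hev : IsEventSeq (u d) (flux f γ lam (u d)) e) (hd : 0 < d)
    (hR : g (lam * M * R ^ (γ + 1 - α)) * R < d) : R ≤ e 1 := by
  by_contra hlt
  have hlt' := not_le.1 hlt
  have h0 := hev.nonneg 1
  have h1 := h.picardData.abs_delayedPicard_sub_le (h.cont d) 0 d hlt'.le (h0.trans hlt'.le)
    (h0.trans hlt'.le) (r := e 1) (s := 0)
  rw [← h.fixed, hev.u_eq_zero 0, (h.isTrajectory d).u_zero, zero_sub, abs_neg, abs_of_pos hd,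
    sub_zero, abs_of_nonneg h0] at h1
  have hg0 : 0 ≤ g (lam * M * R ^ (γ + 1 - α)) := h.inv.nonneg (by
    have := h.exps.lam_pos
    have := h.reaction.bound_pos
    have : 0 ≤ R := h0.trans hlt'.le
    positivity)
  have := mul_le_mul_of_nonneg_left hlt'.le hg0
  linarith

/-! ### Proof of the theorem -/

theorem theorem1p2
    (φ f : ℝ → ℝ) (α γ γ₁ γ₂ R dInf : ℝ)
    (hR : 0 < R)
    -- `φ : (0, ∞) → (0, ∞)` is twice differentiable
    (hφ_pos : ∀ t, 0 < t → 0 < φ t)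
    (hφ_diff : DifferentiableOn ℝ φ (Ioi 0))
    (hφ_diff₂ : DifferentiableOn ℝ (deriv φ) (Ioi 0))
    -- growth conditions on `φ`
    (hφ₁_zero : Tendsto (fun t => t * φ t) (𝓝[>] 0) (𝓝 0))
    (hφ₁_top : Tendsto (fun t => t * φ t) atTop atTop)
    (hφ₂ : StrictMonoOn (fun t => t * φ t) (Ioi 0))
    (hγ₁ : 1 < γ₁) (hγ₂ : 1 < γ₂)
    (hφ₃ : ∀ t, 0 < t →
      γ₁ - 1 ≤ deriv (fun s => s * φ s) t / φ t ∧ deriv (fun s => s * φ s) t / φ t ≤ γ₂ - 1)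
    -- conditions on the exponents
    (hγα : max α (-α / (γ₁ - 1)) ≤ γ)
    -- conditions on `f`
    (hf_cont : Continuous f)
    (hf_C1 : ContDiffOn ℝ 1 f {0}ᶜ)
    (hf₁ : ∀ t, t ≠ 0 → 0 < t * f t)
    (hdInf : 0 < dInf)
    (hf₂ : MonotoneOn f (Iic dInf))
    -- `|f|^(-1/(γ₁ - 1))` is integrable on both sides of `0`
    (hf₃ : ∃ δ > 0, IntegrableOn (fun t => |f t| ^ (-1 / (γ₁ - 1))) (Ioo (-δ) δ)) :
    ∃ Λ > 0, ∀ lam ∈ Ioc 0 Λ, ∃ u : ℝ → ℝ → ℝ,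
      -- `u d` is the unique solution
      (∀ d ∈ Ioc 0 dInf, IsRadialSolution φ f α γ lam d (u d) ∧
        ∀ v, IsRadialSolution φ f α γ lam d v → EqOn v (u d) (Ici 0)) ∧
      -- `z ℓ d`, for `ℓ ≥ 1`, are its zeros
      ∃ z : ℕ → ℝ → ℝ,
        (∀ d ∈ Ioc 0 dInf,
          0 < z 1 d ∧
          (∀ r ∈ Ioo 0 (z 1 d), 0 < u d r) ∧
          (∀ r ∈ Ioc 0 (z 1 d), deriv (u d) r < 0) ∧
          ∀ ℓ, 1 ≤ ℓ →
            z ℓ d < z (ℓ + 1) d ∧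
            u d (z ℓ d) = 0 ∧
            deriv (u d) (z ℓ d) ≠ 0 ∧
            ∀ r ∈ Ioo (z ℓ d) (z (ℓ + 1) d), u d r ≠ 0) ∧
        R ≤ z 1 dInf ∧
        (∀ ℓ, 1 ≤ ℓ →
          Tendsto (z ℓ) (𝓝[>] 0) (𝓝 0) ∧
          ∀ d₀ ∈ Ioc 0 dInf, Tendsto (z ℓ) (𝓝[Ioc 0 dInf] d₀) (𝓝 (z ℓ d₀))) ∧
        (∀ d₀ ∈ Ioc 0 dInf, ∀ k : ℕ, (zerosIn (u d₀) R).encard = k →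
          ∀ᶠ d in 𝓝[<] d₀, (zerosIn (u d) R).encard ≤ k + 1) := by
  set p := γ₁ - 1 with hp_def
  have hp : 0 < p := by linarith
  have hαγ : α ≤ γ := (le_max_left _ _).trans hγα
  have hnegα : -α ≤ γ * p := (div_le_iff₀ hp).1 ((le_max_right _ _).trans hγα)
  -- If γ < 0 then α ≤ γ < 0, so -α > 0 > γ p, a contradiction.
  have hγ : 0 ≤ γ := by
    by_contra hcon
    have h1 := not_le.1 hcon
    nlinarith
  have hφp : ∀ t, 0 < t → p ≤ deriv (fun s => s * φ s) t / φ t := fun t ht => (hφ₃ t ht).1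
  obtain ⟨g, hg, hgφ, hφg⟩ :=
    exists_isFluxInverse hp hφ_pos hφ_diff hφ₁_zero hφ₁_top hφ₂ hφp
  obtain ⟨B, hB, hBD⟩ := exists_primitive_le_primitive_neg hdInf hf_cont hf₁ hf₂
  obtain ⟨M, hM⟩ := exists_isMonotoneReaction_truncated hB hdInf hf_cont hf_C1 hf₁ hf₂ hf₃
  -- The bounds B and M of the truncation were fixed before λ, so the slope bound on [0, R] tends to
  -- 0 with λ.
  have hlimΛ : Tendsto (fun l : ℝ => g (l * M * R ^ (γ + 1 - α)) * R) (𝓝[>] 0) (𝓝 0) := by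
    have h1 : Continuous fun l : ℝ => g (l * M * R ^ (γ + 1 - α)) * R :=
      (hg.cont.comp ((continuous_id.mul continuous_const).mul continuous_const)).mul
        continuous_const
    have h2 := (h1.tendsto 0).mono_left (nhdsWithin_le_nhds (s := Ioi 0))
    simpa only [zero_mul, hg.map_zero] using h2
  obtain ⟨Λ, hΛ, hΛ0⟩ :=
    ((hlimΛ.eventually (gt_mem_nhds hdInf)).and self_mem_nhdsWithin).exists
  refine ⟨Λ, hΛ0, fun lam hlam => ?_⟩
  have he : Exponents α γ p lam := ⟨hγ, hαγ, hnegα, hlam.1⟩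
  choose u hu_cont hu_fix using (IsMonotoneReaction.picardData hg hM he).exists_fixed
  have hS : IsSolutionFamily g (truncated f B dInf) α γ p lam M u := ⟨hg, hM, he, hu_cont, hu_fix⟩
  have hex : ∀ d, ∃ e, 0 < d → IsEventSeq (u d) (flux (truncated f B dInf) γ lam (u d)) e := by
    intro d
    by_cases hd : 0 < d
    · obtain ⟨e, he'⟩ := (hS.isTrajectory d).exists_isEventSeq hg hM he hd
      exact ⟨e, fun _ => he'⟩
    · exact ⟨fun _ => 0, fun h => absurd h hd⟩
  choose e hev using hex
  have hmem_d : ∀ d ∈ Ioc 0 dInf, d ∈ Icc (-B) dInf := fun d hd => ⟨by linarith [hd.1], hd.2⟩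
  have hrange : ∀ d ∈ Ioc 0 dInf, ∀ r, 0 ≤ r → u d r ∈ Icc (-B) dInf := by
    intro d hd r hr
    have hDmem : dInf ∈ Icc (-B) dInf := ⟨by linarith, le_rfl⟩
    have hBmem : -B ∈ Icc (-B) dInf := ⟨le_rfl, by linarith⟩
    -- The well is computed for the truncated f, whose primitive agrees with F at -B and dInf. Hence
    -- these solutions never feel the truncation.
    refine mem_Icc_of_primitive_le hM.cont hM.mul_pos hB ?_ hd
      ((hS.isTrajectory d).primitive_le hg hM.cont he hr)
    rwa [primitive_truncated hB.le hdInf.le hDmem, primitive_truncated hB.le hdInf.le hBmem]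
  -- Odd events are the zeros of u, and the first zero is event 1, hence the index 2ℓ - 1.
  refine ⟨u, fun d hd => ⟨?_, fun v hv => ?_⟩, fun ℓ d => e d (2 * ℓ - 1), fun d hd => ?_, ?_,
    fun ℓ _ => ⟨?_, fun d₀ hd₀ => ?_⟩, fun d₀ hd₀ k hk => ?_⟩
  · exact hS.isRadialSolution hφg fun r hr => truncated_eq (hrange d hd r hr.le)
  -- A competing solution obeys the energy bound for f itself, so it also stays in [-B, dInf] and
  -- solves the truncated problem, where uniqueness holds.
  · have hv' := hv.isTrajectory hg.mono hgφ hφg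
    refine (hv'.congr_reaction fun r hr => ?_).unique hg hM.toIsReaction he (hS.isTrajectory d)
      hd.1.ne'
    exact (truncated_eq (mem_Icc_of_primitive_le hf_cont hf₁ hB hBD hd
      (hv'.primitive_le hg hf_cont he hr.le))).symm
  · have hE := hev d hd.1
    have he1 : 0 < e d 1 := (hE.nonneg 0).trans_lt (hE.lt 0)
    refine ⟨he1, fun r hr => ?_, fun r hr => ?_, fun ℓ hℓ => ?_⟩
    · exact hE.pos 0 r ⟨hE.zero.le.trans hr.1.le, hr.2⟩
    · rw [hS.deriv_eq d hr.1]
      have h1 := hE.pos_succ 0 r ⟨hE.zero.le.trans_lt hr.1, hr.2⟩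
      exact hg.neg (mul_neg_of_pos_of_neg (Real.rpow_pos_of_pos hr.1 _) (neg_pos.1 h1))
    · obtain ⟨k, rfl⟩ : ∃ k, ℓ = k + 1 := ⟨ℓ - 1, by omega⟩
      simp only [show 2 * (k + 1) - 1 = 2 * k + 1 by omega,
        show 2 * (k + 1 + 1) - 1 = 2 * k + 3 by omega]
      refine ⟨hE.strictMono (by omega), hE.u_eq_zero k, ?_, fun r hr => hE.u_ne_zero k hr⟩
      have hpos : 0 < e d (2 * k + 1) := (hE.nonneg _).trans_lt (hE.lt _)
      rw [hS.deriv_eq d hpos, ← hg.map_zero]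
      exact hg.mono.injective.ne
        (mul_ne_zero (Real.rpow_pos_of_pos hpos _).ne' (hE.y_ne_zero k))
  · refine hS.le_first_event (hev dInf hdInf) hdInf (lt_of_le_of_lt ?_ hΛ)
    have h1 := hM.bound_pos
    exact mul_le_mul_of_nonneg_right (hg.mono.monotone (by
      have := hlam.2
      gcongr)) hR.le
  · exact hS.tendsto_event_zero hev _
  · exact (hS.tendsto_event hev hd₀.1 _).mono_left nhdsWithin_le_nhds
  · have hE := hev d₀ hd₀.1
    -- Zero number k + 1 may sit exactly at R and enter (0, R) when d changes. Zero number k + 2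
    -- lies strictly beyond R and stays there, whence the bound k + 1.
    have hRk : R ≤ e d₀ (2 * k + 1) := by
      by_contra hcon
      have h1 := hE.le_encard_zerosIn (not_le.1 hcon)
      rw [hk, Nat.cast_le] at h1
      omega
    have hlt : R < e d₀ (2 * (k + 1) + 1) := hRk.trans_lt (hE.strictMono (by omega))
    filter_upwards [nhdsWithin_le_nhds (lt_mem_nhds hd₀.1),
      nhdsWithin_le_nhds ((hS.tendsto_event hev hd₀.1 _).eventually (lt_mem_nhds hlt))]
      with d hd0 hd1
    have h2 := (hev d hd0).encard_zerosIn_le hd1.le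
    exact_mod_cast h2
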